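/- **Theorem.** Let $G$ be an abelian group and $n\ge 0$. On the category of compact metric pairs, i.e. of pairs $(X,A)$ with $X$ a compact metric space and $A\subset X$ a compact subset, with the continuous maps of pairs as morphisms, there is a natural isomorphism $$H^n_{VR}(X,A,\mathcal F_0;G)\;\cong\;\check H^n(X,A;G).$$ Here: * $\mathcal F_0$ is the semi-uniform structure on $X$ induced by the metric $d$ at scale $0$, i.e. the filter on $X\times X$ of all sets that contain $\{(x,y)\mid d(x,y)<r\}$ for some $r>0$. * For $U\in\mathcal F_0$ and $B\subset X$, let $U_B=U\cap(B\times B)$, and let $\Sigma^B_{U_B}$ be the simplicial complex whose simplices are the non-empty finite subsets of $B$ that admit an ordering $x_0,\dots,x_q$ with $(x_i,x_j)\in U_B$ for all $i<j$. The Vietoris-Rips cohomology is the direct limit of simplicial cohomology groups $$H^n_{VR}(X,A,\mathcal F_0;G)=\varinjlim_{U\in\mathcal F_0}H^n(\Sigma^X_U,\Sigma^A_{U_A};G)$$ over $\mathcal F_0$ ordered by reverse inclusion, along the maps induced by inclusions. A continuous map of pairs $f\colon(X,A)\to(Y,B)$ is uniformly continuous, and induces a homomorphism by pulling back along $f\colon(\Sigma^X_U,\Sigma^A_{U_A})\to(\Sigma^Y_V,\Sigma^B_{V_B})$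 with $U=(f\times f)^{-1}(V)$. * $\check H^n(X,A;G)$ is the Čech cohomology of the pair: the direct limit of the simplicial cohomology groups $H^n(N,N_A;G)$ over the open covers $(\mathcal U,\mathcal U')$ of $(X,A)$ ($\mathcal U$ a family of open sets covering $X$, $\mathcal U'\subset\mathcal U$ covering $A$), ordered by refinement. Here $N$ is the nerve of $\mathcal U$, and $N_A$ is the subcomplex of the finite non-empty subsets of $\mathcal U'$ whose members have a common point in $A$. A continuous map of pairs induces a homomorphism by taking inverse images of covers. -/

import Mathlib

open scoped NNReal

/-! ## Cohomology of simplicial pairs -/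

/-- A simplicial pair `(K, L)`: an abstract simplicial complex `K` with vertices in `V`, and a
subcomplex `L` of `K`. -/
structure SimplicialPair (V : Type*) where
  K : PreAbstractSimplicialComplex V
  L : PreAbstractSimplicialComplex V
  le : L ≤ K

/-- The `m`-tuple `x` is an ordered simplex of `K`: its entries (repetitions allowed) are vertices
of one simplex of `K`. -/
def IsOrdSimplex {V : Type*} (K : PreAbstractSimplicialComplex V) {m : ℕ} (x : Fin m → V) : Prop :=
  ∃ s ∈ K, ∀ i, x i ∈ s

/-- The ordered simplices of `K` with `m` vertices. -/
abbrev OrdSimplex {V : Type*} (K : PreAbstractSimplicialComplex V) (m : ℕ) : Type _ :=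
  {x : Fin m → V // IsOrdSimplex K x}

/-- The `i`-th face of an ordered simplex. -/
def OrdSimplex.face {V : Type*} {K : PreAbstractSimplicialComplex V} {m : ℕ} (i : Fin (m + 1))
    (x : OrdSimplex K (m + 1)) : OrdSimplex K m :=
  ⟨fun j => x.1 (i.succAbove j), by
    obtain ⟨s, hs, h⟩ := x.2
    exact ⟨s, hs, fun j => h _⟩⟩

namespace SimplicialPair

variable {V W Z : Type*}

/-- The group of ordered `n`-cochains of `(K, L)` with coefficients in `G`: the functions on the
ordered `n`-simplices of `K` (tuples of `n + 1` vertices) that vanish on those of `L`. -/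
def cochains (P : SimplicialPair V) (G : Type*) [AddCommGroup G] (n : ℕ) :
    AddSubgroup (OrdSimplex P.K (n + 1) → G) where
  carrier := {f | ∀ x, IsOrdSimplex P.L x.1 → f x = 0}
  zero_mem' := fun _ _ => rfl
  add_mem' := fun {f g} hf hg x hx => by simp [hf x hx, hg x hx]
  neg_mem' := fun {f} hf x hx => by simp [hf x hx]

/-- The simplicial coboundary `(d f)(x₀, …, xₙ₊₁) = ∑ᵢ (-1)ⁱ f(x₀, …, x̂ᵢ, …, xₙ₊₁)`. -/
def coboundary (P : SimplicialPair V) (G : Type*) [AddCommGroup G] (n : ℕ) :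
    P.cochains G n →+ P.cochains G (n + 1) where
  toFun f := ⟨fun x => ∑ i : Fin (n + 2), (-1 : ℤ) ^ (i : ℕ) • f.1 (x.face i), by
    intro x hx
    refine Finset.sum_eq_zero fun i _ => ?_
    have : IsOrdSimplex P.L (x.face i).1 := by
      obtain ⟨s, hs, h⟩ := hx
      exact ⟨s, hs, fun j => h _⟩
    rw [f.2 _ this, smul_zero]⟩
  map_zero' := by ext x; simp
  map_add' f g := by ext x; simp [Finset.sum_add_distrib]

/-- The `n`-cocycles. -/
def cocycles (P : SimplicialPair V) (G : Type*) [AddCommGroup G] (n : ℕ) :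
    AddSubgroup (P.cochains G n) :=
  (P.coboundary G n).ker

/-- The `n`-coboundaries. -/
def coboundaries (P : SimplicialPair V) (G : Type*) [AddCommGroup G] :
    (n : ℕ) → AddSubgroup (P.cochains G n)
  | 0 => ⊥
  | n + 1 => (P.coboundary G n).range

/-- The cohomology group `Hⁿ(K, L; G)`: cocycles modulo coboundaries. -/
abbrev Cohomology (P : SimplicialPair V) (G : Type*) [AddCommGroup G] (n : ℕ) : Type _ :=
  P.cocycles G n ⧸ (P.coboundaries G n).addSubgroupOf (P.cocycles G n)

/-- The vertex map `φ` is simplicial from `K` to `K'`: it sends the vertices of each simplex into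
a simplex. -/
def IsSimplicial (K : PreAbstractSimplicialComplex V) (K' : PreAbstractSimplicialComplex W)
    (φ : V → W) : Prop :=
  ∀ s ∈ K, ∃ t ∈ K', ∀ v ∈ s, φ v ∈ t

/-- The vertex map `φ` is a simplicial map of pairs. -/
structure IsMap (P : SimplicialPair V) (Q : SimplicialPair W) (φ : V → W) : Prop where
  map_K : IsSimplicial P.K Q.K φ
  map_L : IsSimplicial P.L Q.L φ

theorem IsMap.comp {P : SimplicialPair V} {Q : SimplicialPair W} {R : SimplicialPair Z}
    {φ : V → W} {ψ : W → Z} (hψ : IsMap Q R ψ) (hφ : IsMap P Q φ) : IsMap P R (ψ ∘ φ) := by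
  constructor
  · intro s hs
    obtain ⟨t, ht, h⟩ := hφ.map_K s hs
    obtain ⟨u, hu, h'⟩ := hψ.map_K t ht
    exact ⟨u, hu, fun v hv => h' _ (h v hv)⟩
  · intro s hs
    obtain ⟨t, ht, h⟩ := hφ.map_L s hs
    obtain ⟨u, hu, h'⟩ := hψ.map_L t ht
    exact ⟨u, hu, fun v hv => h' _ (h v hv)⟩

theorem IsSimplicial.isOrdSimplex {K : PreAbstractSimplicialComplex V}
    {K' : PreAbstractSimplicialComplex W} {φ : V → W} (h : IsSimplicial K K' φ) {m : ℕ}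
    {x : Fin m → V} (hx : IsOrdSimplex K x) : IsOrdSimplex K' (φ ∘ x) := by
  obtain ⟨s, hs, hxs⟩ := hx
  obtain ⟨t, ht, h'⟩ := h s hs
  exact ⟨t, ht, fun i => h' _ (hxs i)⟩

/-- The pull-back of cochains along a simplicial map of pairs. -/
def pullback {P : SimplicialPair V} {Q : SimplicialPair W} {φ : V → W} (hφ : IsMap P Q φ)
    (G : Type*) [AddCommGroup G] (n : ℕ) : Q.cochains G n →+ P.cochains G n where
  toFun f := ⟨fun x => f.1 ⟨φ ∘ x.1, hφ.map_K.isOrdSimplex x.2⟩,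
    fun _ hx => f.2 _ (hφ.map_L.isOrdSimplex hx)⟩
  map_zero' := rfl
  map_add' _ _ := rfl

theorem coboundary_pullback {P : SimplicialPair V} {Q : SimplicialPair W} {φ : V → W}
    (hφ : IsMap P Q φ) (G : Type*) [AddCommGroup G] (n : ℕ) (f : Q.cochains G n) :
    P.coboundary G n (pullback hφ G n f) = pullback hφ G (n + 1) (Q.coboundary G n f) :=
  rfl

/-- The pull-back of cocycles. -/
def pullbackCocycles {P : SimplicialPair V} {Q : SimplicialPair W} {φ : V → W}
    (hφ : IsMap P Q φ) (G : Type*) [AddCommGroup G] (n : ℕ) :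
    Q.cocycles G n →+ P.cocycles G n :=
  ((pullback hφ G n).comp (Q.cocycles G n).subtype).codRestrict (P.cocycles G n) (by
    rintro ⟨f, hf⟩
    have hf' : Q.coboundary G n f = 0 := hf
    change P.coboundary G n (pullback hφ G n f) = 0
    rw [coboundary_pullback, hf', map_zero])

/-- The homomorphism `φ* : Hⁿ(Q; G) → Hⁿ(P; G)` induced by a simplicial map of pairs
`φ : P → Q`. -/
def cohomologyMap {P : SimplicialPair V} {Q : SimplicialPair W} {φ : V → W}
    (hφ : IsMap P Q φ) (G : Type*) [AddCommGroup G] (n : ℕ) :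
    Q.Cohomology G n →+ P.Cohomology G n :=
  QuotientAddGroup.map _ _ (pullbackCocycles hφ G n) (by
    rintro ⟨f, hf⟩ h
    have h' : f ∈ Q.coboundaries G n := h
    change pullback hφ G n f ∈ P.coboundaries G n
    cases n with
    | zero =>
      have h0 : f = 0 := h'
      rw [h0, map_zero]
      exact zero_mem _
    | succ n =>
      obtain ⟨g, rfl⟩ := h'
      exact ⟨pullback hφ G n g, coboundary_pullback hφ G n g⟩)

theorem cohomologyMap_comp {P : SimplicialPair V} {Q : SimplicialPair W} {R : SimplicialPair Z}
    {φ : V → W} {ψ : W → Z} (hψ : IsMap Q R ψ) (hφ : IsMap P Q φ) (G : Type*) [AddCommGroup G]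
    (n : ℕ) (c : R.Cohomology G n) :
    cohomologyMap hφ G n (cohomologyMap hψ G n c) = cohomologyMap (hψ.comp hφ) G n c := by
  induction c using QuotientAddGroup.induction_on
  rfl

/-! ### Contiguous maps induce the same homomorphism -/

section Contiguous

variable {G : Type*} [AddCommGroup G]

/-- The alternating sum over the faces of a tuple. -/
def faceSum {m : ℕ} (F : (Fin m → V) → G) (x : Fin (m + 1) → V) : G :=
  ∑ i : Fin (m + 1), (-1 : ℤ) ^ (i : ℕ) • F (fun j => x (i.succAbove j))

theorem faceSum_cons {m : ℕ} (F : (Fin (m + 1) → V) → G) (v : V) (x : Fin (m + 1) → V) :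
    faceSum F (Fin.cons v x : Fin (m + 2) → V) =
      F x - faceSum (fun z => F (Fin.cons v z : Fin (m + 1) → V)) x := by
  unfold faceSum
  rw [Fin.sum_univ_succ, sub_eq_add_neg, ← Finset.sum_neg_distrib]
  congr 1
  · simp
  · refine Finset.sum_congr rfl fun i _ => ?_
    have : (fun j => (Fin.cons v x : Fin (m + 2) → V) (i.succ.succAbove j)) =
        (Fin.cons v (fun j => x (i.succAbove j)) : Fin (m + 1) → V) := by
      funext j
      refine Fin.cases ?_ (fun j => ?_) j <;> simp
    rw [this]
    simp [pow_succ]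

/-- The prism operator between `φ` and `ψ`. -/
def prism (φ ψ : V → W) : (m : ℕ) → ((Fin (m + 1) → W) → G) → (Fin m → V) → G
  | 0, _, _ => 0
  | m + 1, F, x => F (Fin.cons (φ (x 0)) (ψ ∘ x)) -
      prism φ ψ m (fun z => F (Fin.cons (φ (x 0)) z)) (Fin.tail x)

theorem prism_sub (φ ψ : V → W) (m : ℕ) (F F' : (Fin (m + 1) → W) → G) (x : Fin m → V) :
    prism φ ψ m (fun z => F z - F' z) x = prism φ ψ m F x - prism φ ψ m F' x := by
  induction m with
  | zero => simp [prism]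
  | succ m ih => simp only [prism, ih]; abel

theorem faceSum_sub {m : ℕ} (F F' : (Fin m → V) → G) (x : Fin (m + 1) → V) :
    faceSum (fun z => F z - F' z) x = faceSum F x - faceSum F' x := by
  simp [faceSum, smul_sub]

theorem prism_congr (φ ψ : V → W) (S : Set W) (m : ℕ) (F F' : (Fin (m + 1) → W) → G)
    (x : Fin m → V) (hF : ∀ z, (∀ i, z i ∈ S) → F z = F' z) (hφ : ∀ i, φ (x i) ∈ S)
    (hψ : ∀ i, ψ (x i) ∈ S) : prism φ ψ m F x = prism φ ψ m F' x := by
  induction m with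
  | zero => rfl
  | succ m ih =>
    simp only [prism]
    congr 1
    · apply hF
      intro i
      refine Fin.cases ?_ (fun i => ?_) i
      · simpa using hφ 0
      · simpa using hψ i
    · apply ih
      · intro z hz
        apply hF
        intro i
        refine Fin.cases ?_ (fun i => ?_) i
        · simpa using hφ 0
        · simpa using hz i
      · exact fun i => hφ _
      · exact fun i => hψ _

theorem prism_zero (φ ψ : V → W) (m : ℕ) (x : Fin m → V) :
    prism φ ψ m (fun _ => (0 : G)) x = 0 := by
  induction m with
  | zero => rfl
  | succ m ih => simp [prism, ih]

theorem faceSum_prism (φ ψ : V → W) (m : ℕ) (F : (Fin (m + 1) → W) → G) (x : Fin (m + 1) → V) :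
    faceSum (prism φ ψ m F) x + prism φ ψ (m + 1) (faceSum F) x = F (ψ ∘ x) - F (φ ∘ x) := by
  have key : ∀ (k : ℕ) (v : V) (y : Fin k → V) (χ : V → W),
      χ ∘ (Fin.cons v y : Fin (k + 1) → V) = (Fin.cons (χ v) (χ ∘ y) : Fin (k + 1) → W) := by
    intro k v y χ
    funext i
    refine Fin.cases ?_ (fun i => ?_) i <;> simp
  induction m with
  | zero =>
    have h0 : ∀ y : Fin 0 → W, (Fin.cons (φ (x 0)) y : Fin 1 → W) = φ ∘ x := by
      intro y; funext i; fin_cases i; simp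
    simp only [prism, faceSum_cons]
    simp [faceSum, h0]
  | succ m ih =>
    obtain ⟨v, y, rfl⟩ : ∃ v y, x = Fin.cons v y := ⟨x 0, Fin.tail x, by simp⟩
    have e1 : prism φ ψ (m + 2) (faceSum F) (Fin.cons v y) =
        F (ψ ∘ (Fin.cons v y : Fin (m + 2) → V)) - F (Fin.cons (φ v) (ψ ∘ y))
          + faceSum (fun z => F (Fin.cons (φ v) (Fin.cons (ψ v) z))) (ψ ∘ y)
          - (prism φ ψ (m + 1) F y
            - prism φ ψ (m + 1) (faceSum fun z => F (Fin.cons (φ v) z)) y) := by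
      rw [prism]
      simp only [faceSum_cons, Fin.cons_zero, Fin.tail_cons, prism_sub, key]
      abel
    have e2 : faceSum (prism φ ψ (m + 1) F) (Fin.cons v y) = prism φ ψ (m + 1) F y
          - (faceSum (fun z => F (Fin.cons (φ v) (Fin.cons (ψ v) z))) (ψ ∘ y)
            - faceSum (prism φ ψ m fun z => F (Fin.cons (φ v) z)) y) := by
      rw [faceSum_cons]
      congr 1
      simp only [prism, Fin.cons_zero, Fin.tail_cons, key, faceSum_sub]
      rfl
    have e3 := ih (fun z => F (Fin.cons (φ v) z)) y
    rw [e1, e2, key _ v y φ]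
    have e4 : prism φ ψ (m + 1) (faceSum fun z => F (Fin.cons (φ v) z)) y =
        F (Fin.cons (φ v) (ψ ∘ y)) - F (Fin.cons (φ v) (φ ∘ y))
          - faceSum (prism φ ψ m fun z => F (Fin.cons (φ v) z)) y := by
      rw [← e3]; abel
    rw [e4]
    abel

/-- The vertex maps `φ` and `ψ` are contiguous from `K` to `K'`. -/
def Contiguous (K : PreAbstractSimplicialComplex V) (K' : PreAbstractSimplicialComplex W)
    (φ ψ : V → W) : Prop :=
  ∀ s ∈ K, ∃ t ∈ K', ∀ v ∈ s, φ v ∈ t ∧ ψ v ∈ t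

theorem cohomologyMap_eq_of_contiguous {P : SimplicialPair V} {Q : SimplicialPair W}
    {φ ψ : V → W} (hφ : IsMap P Q φ) (hψ : IsMap P Q ψ) (hK : Contiguous P.K Q.K φ ψ)
    (hL : Contiguous P.L Q.L φ ψ) (n : ℕ) (c : Q.Cohomology G n) :
    cohomologyMap hφ G n c = cohomologyMap hψ G n c := by
  classical
  induction c using QuotientAddGroup.induction_on with | _ c =>
  obtain ⟨f, hf⟩ := c
  have hf' : Q.coboundary G n f = 0 := hf
  refine QuotientAddGroup.eq.2 ?_
  change -(pullback hφ G n f) + pullback hψ G n f ∈ P.coboundaries G n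
  -- the extension of `f` by zero
  let F : (Fin (n + 1) → W) → G := fun z => if h : IsOrdSimplex Q.K z then f.1 ⟨z, h⟩ else 0
  have hF : ∀ z (h : IsOrdSimplex Q.K z), F z = f.1 ⟨z, h⟩ := fun z h => dif_pos h
  have hdF : ∀ z, IsOrdSimplex Q.K z → faceSum F z = 0 := by
    intro z hz
    have h1 := congrArg (fun g => g.1 ⟨z, hz⟩) hf'
    have h2 : (Q.coboundary G n f).1 ⟨z, hz⟩ = faceSum F z := by
      change ∑ i : Fin (n + 2), (-1 : ℤ) ^ (i : ℕ) • f.1 (OrdSimplex.face i ⟨z, hz⟩) =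
        ∑ i : Fin (n + 2), (-1 : ℤ) ^ (i : ℕ) • F (fun j => z (i.succAbove j))
      refine Finset.sum_congr rfl fun i _ => ?_
      exact congrArg _ (hF _ (OrdSimplex.face i ⟨z, hz⟩).2).symm
    rw [← h2]
    exact h1
  have hkey : ∀ x, IsOrdSimplex P.K x →
      faceSum (prism φ ψ n F) x = F (ψ ∘ x) - F (φ ∘ x) := by
    rintro x ⟨s, hs, hx⟩
    obtain ⟨t, ht, hst⟩ := hK s hs
    have h0 : prism φ ψ (n + 1) (faceSum F) x = 0 := by
      rw [prism_congr φ ψ (t : Set W) (n + 1) (faceSum F) (fun _ => 0) x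
        (fun z hz => hdF z ⟨t, ht, hz⟩) (fun i => (hst _ (hx i)).1) (fun i => (hst _ (hx i)).2),
        prism_zero]
    rw [← faceSum_prism, h0, add_zero]
  have hval : ∀ x : OrdSimplex P.K (n + 1),
      (-(pullback hφ G n f) + pullback hψ G n f).1 x = faceSum (prism φ ψ n F) x.1 := by
    intro x
    rw [hkey x.1 x.2, hF _ (hψ.map_K.isOrdSimplex x.2), hF _ (hφ.map_K.isOrdSimplex x.2),
      sub_eq_neg_add]
    rfl
  cases n with
  | zero =>
    change _ = _
    ext x
    rw [hval]
    simp [faceSum, prism]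
  | succ n =>
    refine ⟨⟨fun x => prism φ ψ (n + 1) F x.1, ?_⟩, ?_⟩
    · rintro x ⟨s, hs, hx⟩
      obtain ⟨t, ht, hst⟩ := hL s hs
      have ht' : t ∈ Q.K := Q.le ht
      change prism φ ψ (n + 1) F x.1 = 0
      rw [prism_congr φ ψ (t : Set W) (n + 1) F (fun _ => 0) x.1
        (fun z hz => by rw [hF z ⟨t, ht', hz⟩]; exact f.2 _ ⟨t, ht, hz⟩)
        (fun i => (hst _ (hx i)).1) (fun i => (hst _ (hx i)).2), prism_zero]
    · ext x
      rw [hval]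
      rfl

end Contiguous

end SimplicialPair

/-! ## Semi-uniform spaces -/

/-- A semi-uniform structure on `X`. Since all members contain the diagonal, the filter is proper
as soon as `X` is non-empty. -/
structure SemiUniformity (X : Type*) where
  filter : Filter (X × X)
  diag_mem : ∀ U ∈ filter, ∀ x, (x, x) ∈ U
  inv_mem : ∀ U ∈ filter, Prod.swap ⁻¹' U ∈ filter

namespace SemiUniformity

/-- The members of a semi-uniform structure, ordered by inclusion. -/
abbrev Entourage {X : Type*} (F : SemiUniformity X) : Type _ := {U : Set (X × X) // U ∈ F.filter}

/-- Uniform continuity of maps between semi-uniform spaces. -/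
def UnifContinuous {X Y : Type*} (F : SemiUniformity X) (F' : SemiUniformity Y) (f : X → Y) :
    Prop :=
  ∀ V ∈ F'.filter, ∃ U ∈ F.filter, ∀ x y, (x, y) ∈ U → (f x, f y) ∈ V

end SemiUniformity

/-- A semi-pseudometric: a symmetric real function on `X × X` that vanishes on the diagonal. -/
structure SemiPseudometric (X : Type*) where
  toFun : X → X → ℝ
  self : ∀ x, toFun x x = 0
  symm : ∀ x y, toFun x y = toFun y x

namespace SemiPseudometric

variable {X : Type*}

/-- The distance of a metric space. -/
def ofMetric (X : Type*) [MetricSpace X] : SemiPseudometric X := ⟨dist, dist_self, dist_comm⟩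

/-- The semi-pseudometric `d_q`, equal to `d - q` where `d > q`, and to `0` where `d ≤ q`. -/
noncomputable def shift (d : SemiPseudometric X) (q : ℝ≥0) : SemiPseudometric X where
  toFun x y := if (q : ℝ) < d.toFun x y then d.toFun x y - q else 0
  self x := by simp [d.self]
  symm x y := by simp only [d.symm x y]

/-- The semi-uniform structure induced by `d`: the sets that contain `{(x, y) | d x y < r}` for
some `r > 0`. -/
def semiUniformity (d : SemiPseudometric X) : SemiUniformity X where
  filter :=
    { sets := {U | ∃ r > 0, ∀ x y, d.toFun x y < r → (x, y) ∈ U}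
      univ_sets := ⟨1, one_pos, fun _ _ _ => trivial⟩
      sets_of_superset := fun ⟨r, hr, h⟩ hUV => ⟨r, hr, fun x y hxy => hUV (h x y hxy)⟩
      inter_sets := fun ⟨r, hr, h⟩ ⟨r', hr', h'⟩ => ⟨min r r', lt_min hr hr', fun x y hxy =>
        ⟨h x y (hxy.trans_le (min_le_left _ _)), h' x y (hxy.trans_le (min_le_right _ _))⟩⟩ }
  diag_mem := fun U ⟨r, hr, h⟩ x => h x x (by rw [d.self]; exact hr)
  inv_mem := fun U ⟨r, hr, h⟩ => ⟨r, hr, fun x y hxy => h y x (by rw [d.symm]; exact hxy)⟩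

/-- The semi-uniform structure `𝓕_q` induced by `d` at scale `q`. -/
noncomputable def semiUniformityAt (d : SemiPseudometric X) (q : ℝ≥0) : SemiUniformity X :=
  (d.shift q).semiUniformity

end SemiPseudometric

/-! ## Vietoris-Rips cohomology -/

/-- The Vietoris-Rips complex of the relation `U ∩ (A × A)` on the set `A`: a non-empty finite
subset of `A` is a simplex if it has an ordering `x₀, …, x_q` with `(x_i, x_j) ∈ U` for `i < j`.
For a symmetric `U` this is the clique complex. -/
def ripsComplex {X : Type*} (U : Set (X × X)) (A : Set X) : PreAbstractSimplicialComplex X where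
  faces := {s | s.Nonempty ∧ (∀ x ∈ s, x ∈ A) ∧
    ∃ l : List X, l.Nodup ∧ (∀ x, x ∈ l ↔ x ∈ s) ∧ l.Pairwise fun x y => (x, y) ∈ U ∩ A ×ˢ A}
  isRelLowerSet_faces := by
    classical
    rintro s ⟨hs, hA, l, hl, hls, hU⟩
    refine ⟨hs, fun t hts ht => ⟨ht, fun x hx => hA x (hts hx), l.filter (· ∈ t),
      hl.filter _, fun x => ?_, hU.filter _⟩⟩
    simp only [List.mem_filter, decide_eq_true_eq, hls]
    exact ⟨fun h => h.2, fun h => ⟨hts h, h⟩⟩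

theorem isSimplicial_ripsComplex {X Y : Type*} {U : Set (X × X)} {A : Set X} {V : Set (Y × Y)}
    {B : Set Y} {f : X → Y} (hf : ∀ x y, (x, y) ∈ U → (f x, f y) ∈ V) (hAB : Set.MapsTo f A B) :
    SimplicialPair.IsSimplicial (ripsComplex U A) (ripsComplex V B) f := by
  classical
  rintro s ⟨hs, hA, l, hl, hls, hU⟩
  refine ⟨s.image f, ⟨hs.image f, ?_, (l.map f).dedup, List.nodup_dedup _, ?_, ?_⟩,
    fun v hv => Finset.mem_image_of_mem f hv⟩
  · intro y hy
    obtain ⟨x, hx, rfl⟩ := Finset.mem_image.1 hy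
    exact hAB (hA x hx)
  · intro y
    simp [hls]
  · refine List.Pairwise.sublist (List.dedup_sublist _) ?_
    rw [List.pairwise_map]
    exact hU.imp fun {x y} h => ⟨hf x y h.1, hAB h.2.1, hAB h.2.2⟩

/-- The simplicial pair `(Σ^X_U, Σ^A_{U_A})`. -/
def ripsPair {X : Type*} (U : Set (X × X)) (A : Set X) : SimplicialPair X where
  K := ripsComplex U Set.univ
  L := ripsComplex U A
  le := by
    rintro s ⟨hs, -, l, hl, hls, hU⟩
    exact ⟨hs, fun _ _ => trivial, l, hl, hls, hU.imp fun h => ⟨h.1, trivial, trivial⟩⟩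

theorem isMap_ripsPair {X Y : Type*} {U : Set (X × X)} {A : Set X} {V : Set (Y × Y)}
    {B : Set Y} {f : X → Y} (hf : ∀ x y, (x, y) ∈ U → (f x, f y) ∈ V) (hAB : Set.MapsTo f A B) :
    (ripsPair U A).IsMap (ripsPair V B) f :=
  ⟨isSimplicial_ripsComplex hf fun _ _ => trivial, isSimplicial_ripsComplex hf hAB⟩

/-- The homomorphism `Hⁿ(Σ^X_U, Σ^A_{U_A}; G) → Hⁿ(Σ^X_{U'}, Σ^A_{U'_A}; G)` induced by the
inclusion, for `U' ⊆ U`. -/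
def ripsRestrict {X : Type*} {U U' : Set (X × X)} (A : Set X) (h : U' ⊆ U) (G : Type*)
    [AddCommGroup G] (n : ℕ) : (ripsPair U A).Cohomology G n →+ (ripsPair U' A).Cohomology G n :=
  SimplicialPair.cohomologyMap
    (isMap_ripsPair (f := id) (fun _ _ hxy => h hxy) (Set.mapsTo_id A)) G n

open Classical in
/-- The Vietoris-Rips cohomology `Hⁿ_VR(X, A, 𝓕; G)`: the direct limit of the groups
`Hⁿ(Σ^X_U, Σ^A_{U_A}; G)` over the members `U` of `𝓕`, ordered by reverse inclusion, along the
homomorphisms induced by the inclusions. -/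
abbrev VRCohomology {X : Type*} (F : SemiUniformity X) (A : Set X) (G : Type*) [AddCommGroup G]
    (n : ℕ) : Type _ :=
  AddCommGroup.DirectLimit
    (fun U : F.Entourageᵒᵈ => (ripsPair (OrderDual.ofDual U).1 A).Cohomology G n)
    (fun U U' (h : U ≤ U') => ripsRestrict A
      (show (OrderDual.ofDual U').1 ⊆ (OrderDual.ofDual U).1 from h) G n)

namespace VRCohomology

variable {X Y : Type*} {F : SemiUniformity X} {F' : SemiUniformity Y} {A : Set X} {B : Set Y}
  {f : X → Y}

open Classical in
/-- The class in `Hⁿ_VR(X, A, 𝓕; G)` of an element of `Hⁿ(Σ^X_U, Σ^A_{U_A}; G)`. -/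
noncomputable def of (F : SemiUniformity X) (A : Set X) (G : Type*) [AddCommGroup G] (n : ℕ)
    {U : Set (X × X)} (hU : U ∈ F.filter) :
    (ripsPair U A).Cohomology G n →+ VRCohomology F A G n :=
  AddCommGroup.DirectLimit.of
    (fun U : F.Entourageᵒᵈ => (ripsPair (OrderDual.ofDual U).1 A).Cohomology G n) _
    (OrderDual.toDual ⟨U, hU⟩)

theorem of_ripsRestrict (G : Type*) [AddCommGroup G] (n : ℕ) {U U' : Set (X × X)}
    (hU : U ∈ F.filter) (hU' : U' ∈ F.filter) (h : U' ⊆ U) (c : (ripsPair U A).Cohomology G n) :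
    of F A G n hU' (ripsRestrict A h G n c) = of F A G n hU c := by
  classical
  have hle : (OrderDual.toDual ⟨U, hU⟩ : F.Entourageᵒᵈ) ≤ OrderDual.toDual ⟨U', hU'⟩ := h
  exact AddCommGroup.DirectLimit.of_f
    (G := fun U : F.Entourageᵒᵈ => (ripsPair (OrderDual.ofDual U).1 A).Cohomology G n)
    (f := fun U U' (h : U ≤ U') => ripsRestrict A
      (show (OrderDual.ofDual U').1 ⊆ (OrderDual.ofDual U).1 from h) G n) hle c

theorem preimage_mem (hf : F.UnifContinuous F' f) {V : Set (Y × Y)} (hV : V ∈ F'.filter) :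
    Prod.map f f ⁻¹' V ∈ F.filter := by
  obtain ⟨U, hU, h⟩ := hf V hV
  exact Filter.mem_of_superset hU fun p hp => h p.1 p.2 hp

/-- The homomorphism `Hⁿ(Σ^Y_V, Σ^B_{V_B}; G) → Hⁿ(Σ^X_U, Σ^A_{U_A}; G)` induced by `f`, where
`U = (f × f)⁻¹ V`. -/
def pullback (hAB : Set.MapsTo f A B) (V : Set (Y × Y)) (G : Type*) [AddCommGroup G] (n : ℕ) :
    (ripsPair V B).Cohomology G n →+ (ripsPair (Prod.map f f ⁻¹' V) A).Cohomology G n :=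
  SimplicialPair.cohomologyMap (isMap_ripsPair (f := f) (fun _ _ h => h) hAB) G n

theorem pullback_ripsRestrict (hAB : Set.MapsTo f A B) {V V' : Set (Y × Y)} (h : V' ⊆ V)
    (G : Type*) [AddCommGroup G] (n : ℕ) (c : (ripsPair V B).Cohomology G n) :
    pullback hAB V' G n (ripsRestrict B h G n c) =
      ripsRestrict A (Set.preimage_mono h) G n (pullback hAB V G n c) := by
  unfold pullback ripsRestrict
  rw [SimplicialPair.cohomologyMap_comp, SimplicialPair.cohomologyMap_comp]

open Classical in
/-- The homomorphism `f* : Hⁿ_VR(Y, B, 𝓕'; G) → Hⁿ_VR(X, A, 𝓕; G)` induced by a uniformly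
continuous map of semi-uniform pairs: it sends the class of `c ∈ Hⁿ(Σ^Y_V, Σ^B_{V_B}; G)` to the
class of `f* c ∈ Hⁿ(Σ^X_U, Σ^A_{U_A}; G)` with `U = (f × f)⁻¹ V`. -/
noncomputable def map (hf : F.UnifContinuous F' f) (hAB : Set.MapsTo f A B)
    (G : Type*) [AddCommGroup G] (n : ℕ) : VRCohomology F' B G n →+ VRCohomology F A G n :=
  AddCommGroup.DirectLimit.lift _ _ _
    (fun V => (of F A G n (preimage_mem hf (OrderDual.ofDual V).2)).comp
      (pullback hAB (OrderDual.ofDual V).1 G n))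
    (by
      intro V V' h c
      simp only [AddMonoidHom.comp_apply]
      rw [pullback_ripsRestrict, of_ripsRestrict])

end VRCohomology

/-! ## Čech cohomology -/

/-- An open cover of the pair `(X, A)`: a family `sets` of open sets that covers `X`, with a
subfamily `sub` that covers `A`. -/
structure CoverPair (X : Type*) [TopologicalSpace X] (A : Set X) where
  sets : Set (Set X)
  sub : Set (Set X)
  isOpen : ∀ U ∈ sets, IsOpen U
  cover : ∀ x, ∃ U ∈ sets, x ∈ U
  sub_subset : sub ⊆ sets
  sub_cover : ∀ x ∈ A, ∃ U ∈ sub, x ∈ U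

namespace CoverPair

variable {X Y Z : Type*} [TopologicalSpace X] [TopologicalSpace Y] [TopologicalSpace Z]
  {A : Set X} {B : Set Y} {C : Set Z}

/-- `𝓤 ≤ 𝓥` means that `𝓥` refines `𝓤`: each member of `𝓥` (of the subfamily of `𝓥`) is contained
in a member of `𝓤` (of the subfamily of `𝓤`). -/
instance : Preorder (CoverPair X A) where
  le 𝓤 𝓥 := (∀ V ∈ 𝓥.sets, ∃ U ∈ 𝓤.sets, V ⊆ U) ∧ (∀ V ∈ 𝓥.sub, ∃ U ∈ 𝓤.sub, V ⊆ U)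
  le_refl 𝓤 := ⟨fun V hV => ⟨V, hV, subset_rfl⟩, fun V hV => ⟨V, hV, subset_rfl⟩⟩
  le_trans 𝓤 𝓥 𝓦 h h' := by
    constructor
    · intro S hS
      obtain ⟨V, hV, hSV⟩ := h'.1 S hS
      obtain ⟨U, hU, hVU⟩ := h.1 V hV
      exact ⟨U, hU, hSV.trans hVU⟩
    · intro S hS
      obtain ⟨V, hV, hSV⟩ := h'.2 S hS
      obtain ⟨U, hU, hVU⟩ := h.2 V hV
      exact ⟨U, hU, hSV.trans hVU⟩

/-- The nerve of the cover of the pair `(X, A)`. The simplices of the large complex are the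
non-empty finite sets of members of `sets` with a common point, those of the subcomplex are the
non-empty finite sets of members of `sub` with a common point in `A`. -/
def nerve (𝓤 : CoverPair X A) : SimplicialPair (Set X) where
  K :=
    { faces := {s | s.Nonempty ∧ (∀ U ∈ s, U ∈ 𝓤.sets) ∧ ∃ x, ∀ U ∈ s, x ∈ U}
      isRelLowerSet_faces := by
        rintro s ⟨hs, h, x, hx⟩
        exact ⟨hs, fun t hts ht =>
          ⟨ht, fun U hU => h U (hts hU), x, fun U hU => hx U (hts hU)⟩⟩ }
  L :=
    { faces := {s | s.Nonempty ∧ (∀ U ∈ s, U ∈ 𝓤.sub) ∧ ∃ x ∈ A, ∀ U ∈ s, x ∈ U}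
      isRelLowerSet_faces := by
        rintro s ⟨hs, h, x, hxA, hx⟩
        exact ⟨hs, fun t hts ht =>
          ⟨ht, fun U hU => h U (hts hU), x, hxA, fun U hU => hx U (hts hU)⟩⟩ }
  le := by
    rintro s ⟨hs, h, x, -, hx⟩
    exact ⟨hs, fun U hU => 𝓤.sub_subset (h U hU), x, hx⟩

/-- `φ` is a projection of `𝓤` to `𝓥` over `f : (X, A) → (Y, B)`: it assigns to each member `U` of
`𝓤` a member of `𝓥` that contains `f(U)`, and respects the subfamilies. For `f = id` these are the
usual projections of a cover to a cover that it refines. -/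
structure IsProjection (f : X → Y) (𝓤 : CoverPair X A) (𝓥 : CoverPair Y B)
    (φ : Set X → Set Y) : Prop where
  mem : ∀ U ∈ 𝓤.sets, φ U ∈ 𝓥.sets
  mapsTo : ∀ U ∈ 𝓤.sets, Set.MapsTo f U (φ U)
  mem_sub : ∀ U ∈ 𝓤.sub, φ U ∈ 𝓥.sub

theorem IsProjection.comp {f : X → Y} {g : Y → Z} {𝓤 : CoverPair X A} {𝓥 : CoverPair Y B}
    {𝓦 : CoverPair Z C} {φ : Set X → Set Y} {ψ : Set Y → Set Z} (hψ : IsProjection g 𝓥 𝓦 ψ)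
    (hφ : IsProjection f 𝓤 𝓥 φ) : IsProjection (g ∘ f) 𝓤 𝓦 (ψ ∘ φ) :=
  ⟨fun U hU => hψ.mem _ (hφ.mem U hU),
    fun U hU => (hψ.mapsTo _ (hφ.mem U hU)).comp (hφ.mapsTo U hU),
    fun U hU => hψ.mem_sub _ (hφ.mem_sub U hU)⟩

theorem exists_isProjection {f : X → Y} {𝓤 : CoverPair X A} {𝓥 : CoverPair Y B}
    (h : ∀ U ∈ 𝓤.sets, ∃ V ∈ 𝓥.sets, Set.MapsTo f U V)
    (h' : ∀ U ∈ 𝓤.sub, ∃ V ∈ 𝓥.sub, Set.MapsTo f U V) : ∃ φ, IsProjection f 𝓤 𝓥 φ := by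
  have : ∀ U : Set X, ∃ V : Set Y,
      (U ∈ 𝓤.sets → V ∈ 𝓥.sets ∧ Set.MapsTo f U V) ∧ (U ∈ 𝓤.sub → V ∈ 𝓥.sub) := by
    intro U
    by_cases hU' : U ∈ 𝓤.sub
    · obtain ⟨V, hV, hUV⟩ := h' U hU'
      exact ⟨V, fun _ => ⟨𝓥.sub_subset hV, hUV⟩, fun _ => hV⟩
    · by_cases hU : U ∈ 𝓤.sets
      · obtain ⟨V, hV, hUV⟩ := h U hU
        exact ⟨V, fun _ => ⟨hV, hUV⟩, fun h => absurd h hU'⟩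
      · exact ⟨∅, fun h => absurd h hU, fun h => absurd h hU'⟩
  choose φ hφ using this
  exact ⟨φ, fun U hU => ((hφ U).1 hU).1, fun U hU => ((hφ U).1 hU).2, fun U hU => (hφ U).2 hU⟩

theorem exists_isProjection_of_le {𝓤 𝓥 : CoverPair X A} (h : 𝓤 ≤ 𝓥) :
    ∃ φ, IsProjection id 𝓥 𝓤 φ :=
  exists_isProjection h.1 h.2

theorem contiguous_of_isProjection {f : X → Y} (hAB : Set.MapsTo f A B) {𝓤 : CoverPair X A}
    {𝓥 : CoverPair Y B} {φ ψ : Set X → Set Y} (hφ : IsProjection f 𝓤 𝓥 φ)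
    (hψ : IsProjection f 𝓤 𝓥 ψ) :
    SimplicialPair.Contiguous 𝓤.nerve.K 𝓥.nerve.K φ ψ ∧
      SimplicialPair.Contiguous 𝓤.nerve.L 𝓥.nerve.L φ ψ := by
  classical
  constructor
  · rintro s ⟨hs, h, x, hx⟩
    refine ⟨s.image φ ∪ s.image ψ, ⟨(hs.image φ).mono Finset.subset_union_left, ?_, f x, ?_⟩, ?_⟩
    · intro V hV
      rcases Finset.mem_union.1 hV with hV | hV <;> obtain ⟨U, hU, rfl⟩ := Finset.mem_image.1 hV
      exacts [hφ.mem U (h U hU), hψ.mem U (h U hU)]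
    · intro V hV
      rcases Finset.mem_union.1 hV with hV | hV <;> obtain ⟨U, hU, rfl⟩ := Finset.mem_image.1 hV
      exacts [hφ.mapsTo U (h U hU) (hx U hU), hψ.mapsTo U (h U hU) (hx U hU)]
    · intro U hU
      exact ⟨Finset.mem_union_left _ (Finset.mem_image_of_mem φ hU),
        Finset.mem_union_right _ (Finset.mem_image_of_mem ψ hU)⟩
  · rintro s ⟨hs, h, x, hxA, hx⟩
    refine ⟨s.image φ ∪ s.image ψ,
      ⟨(hs.image φ).mono Finset.subset_union_left, ?_, f x, hAB hxA, ?_⟩, ?_⟩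
    · intro V hV
      rcases Finset.mem_union.1 hV with hV | hV <;> obtain ⟨U, hU, rfl⟩ := Finset.mem_image.1 hV
      exacts [hφ.mem_sub U (h U hU), hψ.mem_sub U (h U hU)]
    · intro V hV
      rcases Finset.mem_union.1 hV with hV | hV <;> obtain ⟨U, hU, rfl⟩ := Finset.mem_image.1 hV
      exacts [hφ.mapsTo U (𝓤.sub_subset (h U hU)) (hx U hU),
        hψ.mapsTo U (𝓤.sub_subset (h U hU)) (hx U hU)]
    · intro U hU
      exact ⟨Finset.mem_union_left _ (Finset.mem_image_of_mem φ hU),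
        Finset.mem_union_right _ (Finset.mem_image_of_mem ψ hU)⟩

theorem IsProjection.isMap {f : X → Y} (hAB : Set.MapsTo f A B) {𝓤 : CoverPair X A}
    {𝓥 : CoverPair Y B} {φ : Set X → Set Y} (hφ : IsProjection f 𝓤 𝓥 φ) :
    𝓤.nerve.IsMap 𝓥.nerve φ := by
  obtain ⟨hK, hL⟩ := contiguous_of_isProjection hAB hφ hφ
  constructor
  · intro s hs
    obtain ⟨t, ht, h⟩ := hK s hs
    exact ⟨t, ht, fun v hv => (h v hv).1⟩
  · intro s hs
    obtain ⟨t, ht, h⟩ := hL s hs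
    exact ⟨t, ht, fun v hv => (h v hv).1⟩

/-- The homomorphism between the cohomology groups of nerves that is induced by any projection
over `f`. -/
noncomputable def nerveMap {f : X → Y} (hAB : Set.MapsTo f A B) {𝓤 : CoverPair X A}
    {𝓥 : CoverPair Y B} (h : ∃ φ, IsProjection f 𝓤 𝓥 φ) (G : Type*) [AddCommGroup G] (n : ℕ) :
    𝓥.nerve.Cohomology G n →+ 𝓤.nerve.Cohomology G n :=
  SimplicialPair.cohomologyMap (h.choose_spec.isMap hAB) G n

/-- The homomorphism does not depend on the projection. -/
theorem nerveMap_eq {f : X → Y} (hAB : Set.MapsTo f A B) {𝓤 : CoverPair X A}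
    {𝓥 : CoverPair Y B} {φ : Set X → Set Y} (hφ : IsProjection f 𝓤 𝓥 φ) (G : Type*)
    [AddCommGroup G] (n : ℕ) (c : 𝓥.nerve.Cohomology G n) :
    nerveMap hAB ⟨φ, hφ⟩ G n c = SimplicialPair.cohomologyMap (hφ.isMap hAB) G n c := by
  obtain ⟨hK, hL⟩ := contiguous_of_isProjection hAB
    (Exists.choose_spec (⟨φ, hφ⟩ : ∃ φ, IsProjection f 𝓤 𝓥 φ)) hφ
  exact SimplicialPair.cohomologyMap_eq_of_contiguous _ _ hK hL n c

theorem nerveMap_comp {f : X → Y} {g : Y → Z} (hAB : Set.MapsTo f A B) (hBC : Set.MapsTo g B C)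
    {𝓤 : CoverPair X A} {𝓥 : CoverPair Y B} {𝓦 : CoverPair Z C} (h : ∃ φ, IsProjection f 𝓤 𝓥 φ)
    (h' : ∃ ψ, IsProjection g 𝓥 𝓦 ψ) (h'' : ∃ χ, IsProjection (g ∘ f) 𝓤 𝓦 χ)
    (G : Type*) [AddCommGroup G] (n : ℕ) (c : 𝓦.nerve.Cohomology G n) :
    nerveMap hAB h G n (nerveMap hBC h' G n c) = nerveMap (hBC.comp hAB) h'' G n c := by
  obtain ⟨φ, hφ⟩ := h
  obtain ⟨ψ, hψ⟩ := h'
  rw [nerveMap_eq hBC hψ, nerveMap_eq hAB hφ, SimplicialPair.cohomologyMap_comp]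
  exact (nerveMap_eq (hBC.comp hAB) (hψ.comp hφ) G n c).symm

/-- The inverse image of a cover of a pair under a continuous map of pairs. -/
def preimage {f : X → Y} (hf : Continuous f) (hAB : Set.MapsTo f A B) (𝓥 : CoverPair Y B) :
    CoverPair X A where
  sets := Set.preimage f '' 𝓥.sets
  sub := Set.preimage f '' 𝓥.sub
  isOpen := by
    rintro _ ⟨V, hV, rfl⟩
    exact (𝓥.isOpen V hV).preimage hf
  cover x := by
    obtain ⟨V, hV, hx⟩ := 𝓥.cover (f x)
    exact ⟨f ⁻¹' V, ⟨V, hV, rfl⟩, hx⟩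
  sub_subset := Set.image_mono 𝓥.sub_subset
  sub_cover x hx := by
    obtain ⟨V, hV, hx⟩ := 𝓥.sub_cover (f x) (hAB hx)
    exact ⟨f ⁻¹' V, ⟨V, hV, rfl⟩, hx⟩

theorem exists_isProjection_preimage {f : X → Y} (hf : Continuous f) (hAB : Set.MapsTo f A B)
    (𝓥 : CoverPair Y B) : ∃ φ, IsProjection f (𝓥.preimage hf hAB) 𝓥 φ := by
  apply exists_isProjection
  · rintro _ ⟨V, hV, rfl⟩
    exact ⟨V, hV, fun _ h => h⟩
  · rintro _ ⟨V, hV, rfl⟩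
    exact ⟨V, hV, fun _ h => h⟩

theorem preimage_le {f : X → Y} (hf : Continuous f) (hAB : Set.MapsTo f A B)
    {𝓥 𝓥' : CoverPair Y B} (h : 𝓥 ≤ 𝓥') : 𝓥.preimage hf hAB ≤ 𝓥'.preimage hf hAB := by
  constructor
  · rintro _ ⟨V', hV', rfl⟩
    obtain ⟨V, hV, hVV'⟩ := h.1 V' hV'
    exact ⟨f ⁻¹' V, ⟨V, hV, rfl⟩, Set.preimage_mono hVV'⟩
  · rintro _ ⟨V', hV', rfl⟩
    obtain ⟨V, hV, hVV'⟩ := h.2 V' hV'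
    exact ⟨f ⁻¹' V, ⟨V, hV, rfl⟩, Set.preimage_mono hVV'⟩

end CoverPair

open Classical in
/-- The Čech cohomology `Ȟⁿ(X, A; G)`: the direct limit of the cohomology groups of the nerves of
the open covers of the pair, ordered by refinement, along the homomorphisms induced by the
projections. -/
abbrev CechCohomology {X : Type*} [TopologicalSpace X] (A : Set X) (G : Type*) [AddCommGroup G]
    (n : ℕ) : Type _ :=
  AddCommGroup.DirectLimit (fun 𝓤 : CoverPair X A => 𝓤.nerve.Cohomology G n)
    (fun _ _ h => CoverPair.nerveMap (Set.mapsTo_id A) (CoverPair.exists_isProjection_of_le h) G n)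

open Classical in
/-- The homomorphism `f* : Ȟⁿ(Y, B; G) → Ȟⁿ(X, A; G)` induced by a continuous map of pairs: it
sends the class of `c ∈ Hⁿ(N(𝓥); G)` to the class of its image in `Hⁿ(N(f⁻¹𝓥); G)`. -/
noncomputable def CechCohomology.map {X Y : Type*} [TopologicalSpace X] [TopologicalSpace Y]
    {A : Set X} {B : Set Y} {f : X → Y} (hf : Continuous f) (hAB : Set.MapsTo f A B)
    (G : Type*) [AddCommGroup G] (n : ℕ) : CechCohomology B G n →+ CechCohomology A G n :=
  AddCommGroup.DirectLimit.lift _ _ _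
    (fun 𝓥 => (AddCommGroup.DirectLimit.of (fun 𝓤 : CoverPair X A => 𝓤.nerve.Cohomology G n) _
        (𝓥.preimage hf hAB)).comp
      (CoverPair.nerveMap hAB (𝓥.exists_isProjection_preimage hf hAB) G n))
    (by
      intro 𝓥 𝓥' h c
      simp only [AddMonoidHom.comp_apply]
      have hp : ∃ φ, CoverPair.IsProjection f (𝓥'.preimage hf hAB) 𝓥 φ := by
        obtain ⟨φ, hφ⟩ := 𝓥'.exists_isProjection_preimage hf hAB
        obtain ⟨ψ, hψ⟩ := CoverPair.exists_isProjection_of_le h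
        exact ⟨ψ ∘ φ, hψ.comp hφ⟩
      rw [CoverPair.nerveMap_comp hAB (Set.mapsTo_id B) _ _ hp,
        ← AddCommGroup.DirectLimit.of_f (CoverPair.preimage_le hf hAB h),
        CoverPair.nerveMap_comp (Set.mapsTo_id A) hAB _ _ hp])

/-! ## Compact metric pairs -/

universe u v

/-- A compact metric pair `(X, A)`: a compact metric space with a compact subset. -/
structure CompactMetricPair : Type (u + 1) where
  carrier : Type u
  [metric : MetricSpace carrier]
  [compact : CompactSpace carrier]
  sub : Set carrier
  isCompact_sub : IsCompact sub

namespace CompactMetricPair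

attribute [instance] CompactMetricPair.metric CompactMetricPair.compact

/-- Continuous maps of pairs. -/
structure Hom (P Q : CompactMetricPair.{u}) where
  toFun : P.carrier → Q.carrier
  continuous : Continuous toFun
  mapsTo : Set.MapsTo toFun P.sub Q.sub

/-- The semi-uniform structure `𝓕₀` of a compact metric pair: the one induced by the metric at
scale `0`. -/
noncomputable def semiUniformityZero (P : CompactMetricPair.{u}) : SemiUniformity P.carrier :=
  (SemiPseudometric.ofMetric P.carrier).semiUniformityAt 0

theorem shift_zero_toFun {X : Type*} [MetricSpace X] (x y : X) :
    ((SemiPseudometric.ofMetric X).shift 0).toFun x y = dist x y := by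
  have h := dist_nonneg (x := x) (y := y)
  simp only [SemiPseudometric.shift, SemiPseudometric.ofMetric, NNReal.coe_zero, sub_zero]
  split_ifs with h'
  · rfl
  · linarith

theorem Hom.unifContinuous {P Q : CompactMetricPair.{u}} (f : Hom P Q) :
    P.semiUniformityZero.UnifContinuous Q.semiUniformityZero f.toFun := by
  rintro V ⟨r, hr, hV⟩
  obtain ⟨δ, hδ, h⟩ := Metric.uniformContinuous_iff.1
    (CompactSpace.uniformContinuous_of_continuous f.continuous) r hr
  refine ⟨{p | dist p.1 p.2 < δ}, ⟨δ, hδ, fun x y hxy => ?_⟩, fun x y hxy => hV _ _ ?_⟩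
  · rwa [shift_zero_toFun] at hxy
  · rw [shift_zero_toFun]
    exact h hxy

/-- `Hⁿ_VR(X, A, 𝓕₀; G)`. -/
abbrev VR (P : CompactMetricPair.{u}) (G : Type v) [AddCommGroup G] (n : ℕ) : Type _ :=
  VRCohomology P.semiUniformityZero P.sub G n

/-- `Ȟⁿ(X, A; G)`. -/
abbrev Cech (P : CompactMetricPair.{u}) (G : Type v) [AddCommGroup G] (n : ℕ) : Type _ :=
  CechCohomology P.sub G n

/-- The homomorphism of Vietoris-Rips cohomology groups induced by a map of compact metric
pairs. -/
noncomputable def Hom.mapVR {P Q : CompactMetricPair.{u}} (f : Hom P Q) (G : Type v)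
    [AddCommGroup G] (n : ℕ) : Q.VR G n →+ P.VR G n :=
  VRCohomology.map f.unifContinuous f.mapsTo G n

/-- The homomorphism of Čech cohomology groups induced by a map of compact metric pairs. -/
noncomputable def Hom.mapCech {P Q : CompactMetricPair.{u}} (f : Hom P Q) (G : Type v)
    [AddCommGroup G] (n : ℕ) : Q.Cech G n →+ P.Cech G n :=
  CechCohomology.map f.continuous f.mapsTo G n

end CompactMetricPair

/-!
Vietoris-Rips complexes at small scale and nerves of fine covers map to each other, and these maps
are inverse to each other up to refinement and contiguity.

* If every member of a cover `𝓤` is small, choosing a point close to each member (for the members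
  of the subfamily, a point of `A`) is a simplicial map of pairs from the nerve of `𝓤` to a
  Vietoris-Rips pair: two members with a common point are sent to nearby points. Such a choice is
  a *sampling*.
* If `δ` is a Lebesgue number of `𝓤`, choosing for each point `x` a member of `𝓤` that contains
  the `δ`-ball around `x` (for `x ∈ A`, a member of the subfamily) is a simplicial map of pairs
  from the Vietoris-Rips pair at scale `δ` to the nerve of `𝓤`: the members assigned to the
  vertices of a simplex all contain each of these vertices. Such a choice is a *selection*.

Any two samplings are contiguous, and so are any two selections, hence the induced homomorphisms do
not depend on the choices and pass to the direct limits (`vrToCech`, `cechToVR`). A selection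
followed by a sampling moves points by little, so it is contiguous to an inclusion of Vietoris-Rips
complexes; a sampling followed by a selection is a projection of covers. So the two homomorphisms
are inverse to each other. Naturality holds because sampling commutes with a uniformly continuous
map up to contiguity; to express this, samplings are defined over an arbitrary map `f`.

The empty space is treated separately, because there is no map from its power set to it; all its
cohomology groups vanish.
-/

/-! ### Vietoris-Rips complexes of a metric space -/

section Rips

variable {X : Type*} [MetricSpace X]

/-- The pairs of points of `X` at distance less than `r`. -/
def nearDiagonal (X : Type*) [MetricSpace X] (r : ℝ) : Set (X × X) := {p | dist p.1 p.2 < r}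

/-- The semi-uniform structure `F` is the one given by the metric of `X`. -/
def IsMetricSemiUniformity (F : SemiUniformity X) : Prop :=
  ∀ U, U ∈ F.filter ↔ ∃ r > 0, nearDiagonal X r ⊆ U

theorem nearDiagonal_mono {r s : ℝ} (h : r ≤ s) : nearDiagonal X r ⊆ nearDiagonal X s :=
  fun _ hp => lt_of_lt_of_le hp h

theorem IsMetricSemiUniformity.nearDiagonal_mem {F : SemiUniformity X}
    (hF : IsMetricSemiUniformity F) {r : ℝ} (hr : 0 < r) : nearDiagonal X r ∈ F.filter :=
  (hF _).2 ⟨r, hr, subset_rfl⟩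

theorem dist_lt_of_mem_ripsComplex {U : Set (X × X)} {A : Set X} {δ : ℝ} (hδ : 0 < δ)
    (hU : U ⊆ nearDiagonal X δ) {s : Finset X} (hs : s ∈ ripsComplex U A) {x y : X} (hx : x ∈ s)
    (hy : y ∈ s) : dist x y < δ := by
  obtain ⟨-, -, l, -, hls, hl⟩ := hs
  have hl' : l.Pairwise fun x y => dist x y < δ := hl.imp fun h => hU h.1
  have : Std.Symm fun x y : X => dist x y < δ := ⟨fun x y h => by rwa [dist_comm]⟩
  exact hl'.forall_of_forall (fun x _ => by simpa using hδ) ((hls x).2 hx) ((hls y).2 hy)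

/-- Finitely many points of `A` within distance `r` of one point of `X` span a simplex. -/
theorem mem_ripsComplex_of_dist_lt {V : Set (X × X)} {A : Set X} {r : ℝ}
    (hV : nearDiagonal X (r + r) ⊆ V) {s : Finset X} (hs : s.Nonempty) (hA : ∀ x ∈ s, x ∈ A)
    {p : X} (hp : ∀ x ∈ s, dist x p < r) : s ∈ ripsComplex V A := by
  refine ⟨hs, hA, s.toList, s.nodup_toList, fun x => Finset.mem_toList,
    List.pairwise_of_forall_mem_list fun x hx y hy => ?_⟩
  rw [Finset.mem_toList] at hx hy
  exact ⟨hV ((dist_triangle_right x y p).trans_lt (add_lt_add (hp x hx) (hp y hy))),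
    hA x hx, hA y hy⟩

end Rips

/-- A map contiguous to another map, or to itself, is simplicial. -/
theorem SimplicialPair.Contiguous.isSimplicial {V W : Type*} {K : PreAbstractSimplicialComplex V}
    {K' : PreAbstractSimplicialComplex W} {φ ψ : V → W} (h : SimplicialPair.Contiguous K K' φ ψ) :
    SimplicialPair.IsSimplicial K K' φ := fun s hs =>
  let ⟨t, ht, hst⟩ := h s hs
  ⟨t, ht, fun v hv => (hst v hv).1⟩

/-- Two vertex maps to a metric space are contiguous to a Vietoris-Rips complex if they send each
simplex to points close to one point. -/
theorem contiguous_ripsComplex {V X : Type*} [MetricSpace X] {K : PreAbstractSimplicialComplex V}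
    {φ ψ : V → X} {U : Set (X × X)} {A : Set X} {r : ℝ}
    (hU : nearDiagonal X (r + r) ⊆ U)
    (h : ∀ s ∈ K, ∃ p, ∀ v ∈ s, (φ v ∈ A ∧ dist (φ v) p < r) ∧ (ψ v ∈ A ∧ dist (ψ v) p < r)) :
    SimplicialPair.Contiguous K (ripsComplex U A) φ ψ := by
  classical
  intro s hs
  obtain ⟨p, hp⟩ := h s hs
  have key : ∀ x ∈ s.image φ ∪ s.image ψ, x ∈ A ∧ dist x p < r := by
    intro x hx
    rcases Finset.mem_union.1 hx with hx | hx <;> obtain ⟨v, hv, rfl⟩ := Finset.mem_image.1 hx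
    exacts [(hp v hv).1, (hp v hv).2]
  exact ⟨s.image φ ∪ s.image ψ, mem_ripsComplex_of_dist_lt hU
      (((K.isRelLowerSet_faces hs).1.image φ).mono Finset.subset_union_left) (fun x hx => (key x hx).1)
      (fun x hx => (key x hx).2),
    fun v hv => ⟨Finset.mem_union_left _ (Finset.mem_image_of_mem φ hv),
      Finset.mem_union_right _ (Finset.mem_image_of_mem ψ hv)⟩⟩

/-! ### The direct limits -/

theorem VRCohomology.hom_ext {X : Type*} {F : SemiUniformity X} {A : Set X} {G H : Type*}
    [AddCommGroup G] [AddCommMonoid H] {n : ℕ} {g g' : VRCohomology F A G n →+ H}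
    (h : ∀ (V : Set (X × X)) (hV : V ∈ F.filter) (c : (ripsPair V A).Cohomology G n),
      g (of F A G n hV c) = g' (of F A G n hV c)) : g = g' := by
  classical
  exact AddCommGroup.DirectLimit.hom_ext _ fun V =>
    AddMonoidHom.ext fun c => h _ (OrderDual.ofDual V).2 c

section Cech

variable {X : Type*} [TopologicalSpace X] {A : Set X} {G : Type*} [AddCommGroup G] {n : ℕ}

open Classical in
/-- The class in `Ȟⁿ(X, A; G)` of an element of the cohomology group of a nerve. -/
noncomputable def CechCohomology.of (G : Type*) [AddCommGroup G] (n : ℕ) (𝓤 : CoverPair X A) :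
    𝓤.nerve.Cohomology G n →+ CechCohomology A G n :=
  AddCommGroup.DirectLimit.of (fun 𝓤 : CoverPair X A => 𝓤.nerve.Cohomology G n) _ 𝓤

theorem CechCohomology.hom_ext {H : Type*} [AddCommMonoid H] {g g' : CechCohomology A G n →+ H}
    (h : ∀ (𝓤 : CoverPair X A) (c : 𝓤.nerve.Cohomology G n),
      g (of G n 𝓤 c) = g' (of G n 𝓤 c)) : g = g' := by
  classical
  exact AddCommGroup.DirectLimit.hom_ext _ fun 𝓤 => AddMonoidHom.ext fun c => h 𝓤 c

theorem CechCohomology.of_projection {𝓤 𝓥 : CoverPair X A} {φ : Set X → Set X}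
    (hφ : CoverPair.IsProjection id 𝓥 𝓤 φ) (c : 𝓤.nerve.Cohomology G n) :
    of G n 𝓥 (SimplicialPair.cohomologyMap (hφ.isMap (Set.mapsTo_id A)) G n c) = of G n 𝓤 c := by
  classical
  have hle : 𝓤 ≤ 𝓥 := ⟨fun V hV => ⟨φ V, hφ.mem V hV, hφ.mapsTo V hV⟩,
    fun V hV => ⟨φ V, hφ.mem_sub V hV, hφ.mapsTo V (𝓥.sub_subset hV)⟩⟩
  rw [← CoverPair.nerveMap_eq (Set.mapsTo_id A) hφ]
  exact AddCommGroup.DirectLimit.of_f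
    (G := fun 𝓤 : CoverPair X A => 𝓤.nerve.Cohomology G n)
    (f := fun _ _ h =>
      CoverPair.nerveMap (Set.mapsTo_id A) (CoverPair.exists_isProjection_of_le h) G n) hle c

theorem CechCohomology.map_of {Y : Type*} [TopologicalSpace Y] {B : Set Y} {f : X → Y}
    (hf : Continuous f) (hAB : Set.MapsTo f A B) {𝓥 : CoverPair Y B} {φ : Set X → Set Y}
    (hφ : CoverPair.IsProjection f (𝓥.preimage hf hAB) 𝓥 φ) (c : 𝓥.nerve.Cohomology G n) :
    CechCohomology.map hf hAB G n (of G n 𝓥 c) =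
      of G n (𝓥.preimage hf hAB) (SimplicialPair.cohomologyMap (hφ.isMap hAB) G n c) := by
  classical
  rw [← CoverPair.nerveMap_eq hAB hφ]
  exact AddCommGroup.DirectLimit.lift_of _ _ _ _ _

/-- The common refinement of two covers of a pair by intersections of their members. -/
def CoverPair.inter (𝓤 𝓥 : CoverPair X A) : CoverPair X A where
  sets := Set.image2 (· ∩ ·) 𝓤.sets 𝓥.sets
  sub := Set.image2 (· ∩ ·) 𝓤.sub 𝓥.sub
  isOpen := by
    rintro _ ⟨U, hU, V, hV, rfl⟩
    exact (𝓤.isOpen U hU).inter (𝓥.isOpen V hV)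
  cover x := by
    obtain ⟨U, hU, hx⟩ := 𝓤.cover x
    obtain ⟨V, hV, hx'⟩ := 𝓥.cover x
    exact ⟨U ∩ V, ⟨U, hU, V, hV, rfl⟩, hx, hx'⟩
  sub_subset := Set.image2_subset 𝓤.sub_subset 𝓥.sub_subset
  sub_cover x hxA := by
    obtain ⟨U, hU, hx⟩ := 𝓤.sub_cover x hxA
    obtain ⟨V, hV, hx'⟩ := 𝓥.sub_cover x hxA
    exact ⟨U ∩ V, ⟨U, hU, V, hV, rfl⟩, hx, hx'⟩

theorem CoverPair.le_inter_left (𝓤 𝓥 : CoverPair X A) : 𝓤 ≤ 𝓤.inter 𝓥 := by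
  constructor <;> rintro _ ⟨U, hU, V, hV, rfl⟩ <;> exact ⟨U, hU, Set.inter_subset_left⟩

theorem CoverPair.le_inter_right (𝓤 𝓥 : CoverPair X A) : 𝓥 ≤ 𝓤.inter 𝓥 := by
  constructor <;> rintro _ ⟨U, hU, V, hV, rfl⟩ <;> exact ⟨V, hV, Set.inter_subset_right⟩

end Cech

/-! ### Samplings: from nerves to Vietoris-Rips complexes -/

section Sampling

variable {X Y Z : Type*} [TopologicalSpace X] [MetricSpace Y] {A : Set X} {B : Set Y}
  {f : X → Y} {𝓤 𝓥 : CoverPair X A} {r : ℝ} {φ ψ : Set X → Y} {V : Set (Y × Y)}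

/-- `φ` is an `r`-sampling of `𝓤` over `f : (X, A) → (Y, B)`: it assigns to each member `U` of `𝓤`
a point of `Y` within distance `r` of all points of `f(U)`, which lies in `B` if `U` belongs to the
subfamily. -/
structure IsSampling (f : X → Y) (𝓤 : CoverPair X A) (B : Set Y) (r : ℝ) (φ : Set X → Y) :
    Prop where
  dist_lt : ∀ U ∈ 𝓤.sets, ∀ x ∈ U, dist (φ U) (f x) < r
  mem_sub : ∀ U ∈ 𝓤.sub, φ U ∈ B

theorem IsSampling.mono {r' : ℝ} (hφ : IsSampling f 𝓤 B r φ) (h : r ≤ r') :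
    IsSampling f 𝓤 B r' φ :=
  ⟨fun U hU x hx => (hφ.dist_lt U hU x hx).trans_le h, hφ.mem_sub⟩

theorem IsSampling.comp_projection [TopologicalSpace Z] {C : Set Z} {g : Z → X}
    {𝓦 : CoverPair Z C} {p : Set Z → Set X} (hφ : IsSampling f 𝓤 B r φ)
    (hp : CoverPair.IsProjection g 𝓦 𝓤 p) : IsSampling (f ∘ g) 𝓦 B r (φ ∘ p) :=
  ⟨fun W hW _ hx => hφ.dist_lt _ (hp.mem W hW) _ (hp.mapsTo W hW hx),
    fun W hW => hφ.mem_sub _ (hp.mem_sub W hW)⟩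

theorem IsSampling.contiguous (hφ : IsSampling f 𝓤 B r φ) (hψ : IsSampling f 𝓤 B r ψ)
    (hV : nearDiagonal Y (r + r) ⊆ V) :
    SimplicialPair.Contiguous 𝓤.nerve.K (ripsPair V B).K φ ψ ∧
      SimplicialPair.Contiguous 𝓤.nerve.L (ripsPair V B).L φ ψ := by
  constructor
  · refine contiguous_ripsComplex hV ?_
    rintro s ⟨-, h, x, hx⟩
    exact ⟨f x, fun U hU => ⟨⟨trivial, hφ.dist_lt U (h U hU) x (hx U hU)⟩,
      ⟨trivial, hψ.dist_lt U (h U hU) x (hx U hU)⟩⟩⟩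
  · refine contiguous_ripsComplex hV ?_
    rintro s ⟨-, h, x, -, hx⟩
    exact ⟨f x, fun U hU =>
      ⟨⟨hφ.mem_sub U (h U hU), hφ.dist_lt U (𝓤.sub_subset (h U hU)) x (hx U hU)⟩,
        ⟨hψ.mem_sub U (h U hU), hψ.dist_lt U (𝓤.sub_subset (h U hU)) x (hx U hU)⟩⟩⟩

theorem IsSampling.isMap (hφ : IsSampling f 𝓤 B r φ) (hV : nearDiagonal Y (r + r) ⊆ V) :
    𝓤.nerve.IsMap (ripsPair V B) φ :=
  ⟨(hφ.contiguous hφ hV).1.isSimplicial, (hφ.contiguous hφ hV).2.isSimplicial⟩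

/-- All samplings over `f`, of whatever covers, send a class of the Vietoris-Rips pair to the same
Čech class: on a common refinement they become contiguous. -/
theorem IsSampling.of_eq_of {r' : ℝ} (hφ : IsSampling f 𝓤 B r φ)
    (hV : nearDiagonal Y (r + r) ⊆ V) (hψ : IsSampling f 𝓥 B r' ψ)
    (hV' : nearDiagonal Y (r' + r') ⊆ V) {G : Type*} [AddCommGroup G] {n : ℕ}
    (c : (ripsPair V B).Cohomology G n) :
    CechCohomology.of G n 𝓤 (SimplicialPair.cohomologyMap (hφ.isMap hV) G n c) =
      CechCohomology.of G n 𝓥 (SimplicialPair.cohomologyMap (hψ.isMap hV') G n c) := by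
  obtain ⟨p, hp⟩ := CoverPair.exists_isProjection_of_le (𝓤.le_inter_left 𝓥)
  obtain ⟨q, hq⟩ := CoverPair.exists_isProjection_of_le (𝓤.le_inter_right 𝓥)
  rw [← CechCohomology.of_projection hp, ← CechCohomology.of_projection hq,
    SimplicialPair.cohomologyMap_comp, SimplicialPair.cohomologyMap_comp]
  congr 1
  have hV'' : nearDiagonal Y (max r r' + max r r') ⊆ V := by
    rcases max_choice r r' with h | h <;> rwa [h]
  obtain ⟨hK, hL⟩ := ((hφ.comp_projection hp).mono (le_max_left r r')).contiguous
    ((hψ.comp_projection hq).mono (le_max_right r r')) hV''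
  exact SimplicialPair.cohomologyMap_eq_of_contiguous _ _ hK hL n c

/-- The cover by the `r`-balls, those with centre in `A` forming the subfamily, is sampled by
centres of its members. -/
theorem exists_isSampling {X : Type*} [MetricSpace X] [Nonempty X] (A : Set X) {r : ℝ}
    (hr : 0 < r) : ∃ (𝓤 : CoverPair X A) (φ : Set X → X), IsSampling id 𝓤 A r φ := by
  classical
  let 𝓤 : CoverPair X A :=
    { sets := Set.range fun x => Metric.ball x r
      sub := (fun x => Metric.ball x r) '' A
      isOpen := by
        rintro _ ⟨x, rfl⟩
        exact Metric.isOpen_ball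
      cover := fun x => ⟨Metric.ball x r, ⟨x, rfl⟩, Metric.mem_ball_self hr⟩
      sub_subset := Set.image_subset_range _ _
      sub_cover := fun x hx => ⟨Metric.ball x r, ⟨x, hx, rfl⟩, Metric.mem_ball_self hr⟩ }
  have h : ∀ U : Set X, ∃ y, (U ∈ 𝓤.sets → ∀ x ∈ U, dist y x < r) ∧ (U ∈ 𝓤.sub → y ∈ A) := by
    intro U
    by_cases hU : U ∈ 𝓤.sub
    · obtain ⟨y, hy, rfl⟩ := hU
      exact ⟨y, fun _ x hx => Metric.mem_ball'.1 hx, fun _ => hy⟩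
    · by_cases hU' : U ∈ 𝓤.sets
      · obtain ⟨y, rfl⟩ := hU'
        exact ⟨y, fun _ x hx => Metric.mem_ball'.1 hx, fun h => absurd h hU⟩
      · exact ⟨Classical.arbitrary X, fun h => absurd h hU', fun h => absurd h hU⟩
  choose φ hφ using h
  exact ⟨𝓤, φ, fun U hU => (hφ U).1 hU, fun U hU => (hφ U).2 hU⟩

end Sampling

/-! ### Selections: from Vietoris-Rips complexes to nerves -/

section Selection

variable {X : Type*} [MetricSpace X] {A : Set X} {𝓤 : CoverPair X A} {δ : ℝ} {φ ψ : X → Set X}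
  {V : Set (X × X)}

/-- `φ` is a `δ`-selection of `𝓤`: it assigns to each point `x` a member of `𝓤` that contains the
`δ`-ball around `x`, and belongs to the subfamily if `x ∈ A`. -/
structure IsSelection (𝓤 : CoverPair X A) (δ : ℝ) (φ : X → Set X) : Prop where
  pos : 0 < δ
  mem : ∀ x, φ x ∈ 𝓤.sets
  ball_subset : ∀ x, Metric.ball x δ ⊆ φ x
  mem_sub : ∀ x ∈ A, φ x ∈ 𝓤.sub

theorem IsSelection.mono {δ' : ℝ} (hφ : IsSelection 𝓤 δ φ) (hδ' : 0 < δ') (h : δ' ≤ δ) :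
    IsSelection 𝓤 δ' φ :=
  ⟨hδ', hφ.mem, fun x => (Metric.ball_subset_ball h).trans (hφ.ball_subset x), hφ.mem_sub⟩

theorem IsSelection.comp_projection {𝓥 : CoverPair X A} {p : Set X → Set X}
    (hφ : IsSelection 𝓤 δ φ) (hp : CoverPair.IsProjection id 𝓤 𝓥 p) :
    IsSelection 𝓥 δ (p ∘ φ) :=
  ⟨hφ.pos, fun x => hp.mem _ (hφ.mem x),
    fun x _ hy => hp.mapsTo _ (hφ.mem x) (hφ.ball_subset x hy),
    fun x hx => hp.mem_sub _ (hφ.mem_sub x hx)⟩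

theorem IsSelection.contiguous (hφ : IsSelection 𝓤 δ φ) (hψ : IsSelection 𝓤 δ ψ)
    (hV : V ⊆ nearDiagonal X δ) :
    SimplicialPair.Contiguous (ripsPair V A).K 𝓤.nerve.K φ ψ ∧
      SimplicialPair.Contiguous (ripsPair V A).L 𝓤.nerve.L φ ψ := by
  classical
  constructor
  · intro s hs
    obtain ⟨x, hx⟩ := hs.1
    refine ⟨s.image φ ∪ s.image ψ, ⟨(hs.1.image φ).mono Finset.subset_union_left, ?_, x, ?_⟩,
      fun y hy => ⟨Finset.mem_union_left _ (Finset.mem_image_of_mem φ hy),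
        Finset.mem_union_right _ (Finset.mem_image_of_mem ψ hy)⟩⟩
    · intro U hU
      rcases Finset.mem_union.1 hU with hU | hU <;> obtain ⟨y, hy, rfl⟩ := Finset.mem_image.1 hU
      exacts [hφ.mem y, hψ.mem y]
    · intro U hU
      rcases Finset.mem_union.1 hU with hU | hU <;> obtain ⟨y, hy, rfl⟩ := Finset.mem_image.1 hU
      exacts [hφ.ball_subset y (dist_lt_of_mem_ripsComplex hφ.pos hV hs hx hy),
        hψ.ball_subset y (dist_lt_of_mem_ripsComplex hφ.pos hV hs hx hy)]
  · intro s hs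
    obtain ⟨x, hx⟩ := hs.1
    refine ⟨s.image φ ∪ s.image ψ,
      ⟨(hs.1.image φ).mono Finset.subset_union_left, ?_, x, hs.2.1 x hx, ?_⟩,
      fun y hy => ⟨Finset.mem_union_left _ (Finset.mem_image_of_mem φ hy),
        Finset.mem_union_right _ (Finset.mem_image_of_mem ψ hy)⟩⟩
    · intro U hU
      rcases Finset.mem_union.1 hU with hU | hU <;> obtain ⟨y, hy, rfl⟩ := Finset.mem_image.1 hU
      exacts [hφ.mem_sub y (hs.2.1 y hy), hψ.mem_sub y (hs.2.1 y hy)]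
    · intro U hU
      rcases Finset.mem_union.1 hU with hU | hU <;> obtain ⟨y, hy, rfl⟩ := Finset.mem_image.1 hU
      exacts [hφ.ball_subset y (dist_lt_of_mem_ripsComplex hφ.pos hV hs hx hy),
        hψ.ball_subset y (dist_lt_of_mem_ripsComplex hφ.pos hV hs hx hy)]

theorem IsSelection.isMap (hφ : IsSelection 𝓤 δ φ) (hV : V ⊆ nearDiagonal X δ) :
    (ripsPair V A).IsMap 𝓤.nerve φ :=
  ⟨(hφ.contiguous hφ hV).1.isSimplicial, (hφ.contiguous hφ hV).2.isSimplicial⟩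

/-- All selections of `𝓤`, at whatever scales, send a class of the nerve to the same
Vietoris-Rips class. -/
theorem IsSelection.of_eq_of {F : SemiUniformity X} {δ' : ℝ} {V' : Set (X × X)}
    (hφ : IsSelection 𝓤 δ φ) (hV : V ⊆ nearDiagonal X δ) (hVF : V ∈ F.filter)
    (hψ : IsSelection 𝓤 δ' ψ) (hV' : V' ⊆ nearDiagonal X δ') (hVF' : V' ∈ F.filter)
    {G : Type*} [AddCommGroup G] {n : ℕ} (c : 𝓤.nerve.Cohomology G n) :
    VRCohomology.of F A G n hVF (SimplicialPair.cohomologyMap (hφ.isMap hV) G n c) =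
      VRCohomology.of F A G n hVF' (SimplicialPair.cohomologyMap (hψ.isMap hV') G n c) := by
  have hW : V ∩ V' ∈ F.filter := Filter.inter_mem hVF hVF'
  rw [← VRCohomology.of_ripsRestrict G n hVF hW Set.inter_subset_left,
    ← VRCohomology.of_ripsRestrict G n hVF' hW Set.inter_subset_right, ripsRestrict, ripsRestrict,
    SimplicialPair.cohomologyMap_comp, SimplicialPair.cohomologyMap_comp]
  congr 1
  have hmin : V ∩ V' ⊆ nearDiagonal X (min δ δ') :=
    fun p hp => lt_min (a := dist p.1 p.2) (hV hp.1) (hV' hp.2)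
  obtain ⟨hK, hL⟩ := (hφ.mono (lt_min hφ.pos hψ.pos) (min_le_left δ δ')).contiguous
    (hψ.mono (lt_min hφ.pos hψ.pos) (min_le_right δ δ')) hmin
  exact SimplicialPair.cohomologyMap_eq_of_contiguous _ _ hK hL n c

theorem exists_isSelection [CompactSpace X] (hA : IsCompact A) (𝓤 : CoverPair X A) :
    ∃ (δ : ℝ) (φ : X → Set X), IsSelection 𝓤 δ φ := by
  obtain ⟨δ, hδ, h⟩ := lebesgue_number_lemma_of_metric_sUnion isCompact_univ 𝓤.isOpen
    (fun x _ => Set.mem_sUnion.2 (𝓤.cover x))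
  obtain ⟨δ', hδ', h'⟩ := lebesgue_number_lemma_of_metric_sUnion hA
    (fun U hU => 𝓤.isOpen U (𝓤.sub_subset hU)) (fun x hx => Set.mem_sUnion.2 (𝓤.sub_cover x hx))
  have key : ∀ x, ∃ U, U ∈ 𝓤.sets ∧ Metric.ball x (min δ δ') ⊆ U ∧ (x ∈ A → U ∈ 𝓤.sub) := by
    intro x
    by_cases hx : x ∈ A
    · obtain ⟨U, hU, hxU⟩ := h' x hx
      exact ⟨U, 𝓤.sub_subset hU, (Metric.ball_subset_ball (min_le_right _ _)).trans hxU,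
        fun _ => hU⟩
    · obtain ⟨U, hU, hxU⟩ := h x trivial
      exact ⟨U, hU, (Metric.ball_subset_ball (min_le_left _ _)).trans hxU, fun h => absurd h hx⟩
  choose φ hφ using key
  exact ⟨min δ δ', φ, lt_min hδ hδ', fun x => (hφ x).1, fun x => (hφ x).2.1,
    fun x hx => (hφ x).2.2 hx⟩

end Selection

/-! ### The isomorphism -/

section Iso

variable {X : Type*} [MetricSpace X] {A : Set X} {F : SemiUniformity X}

theorem exists_isSampling_of_mem [Nonempty X] (A : Set X) (hF : IsMetricSemiUniformity F)
    {V : Set (X × X)} (hV : V ∈ F.filter) :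
    ∃ (r : ℝ) (𝓤 : CoverPair X A) (φ : Set X → X),
      nearDiagonal X (r + r) ⊆ V ∧ IsSampling id 𝓤 A r φ := by
  obtain ⟨r, hr, h⟩ := (hF V).1 hV
  obtain ⟨𝓤, φ, hφ⟩ := exists_isSampling A (half_pos hr)
  exact ⟨r / 2, 𝓤, φ, by rwa [add_halves], hφ⟩

/-- The homomorphism from the cohomology of a Vietoris-Rips pair to Čech cohomology that is induced
by any sampling. -/
noncomputable def ripsToCech [Nonempty X] (A : Set X) (hF : IsMetricSemiUniformity F) (G : Type*)
    [AddCommGroup G] (n : ℕ) {V : Set (X × X)} (hV : V ∈ F.filter) :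
    (ripsPair V A).Cohomology G n →+ CechCohomology A G n :=
  have h := (exists_isSampling_of_mem A hF hV).choose_spec.choose_spec.choose_spec
  (CechCohomology.of G n _).comp (SimplicialPair.cohomologyMap (h.2.isMap h.1) G n)

theorem ripsToCech_eq [Nonempty X] (hF : IsMetricSemiUniformity F) {G : Type*}
    [AddCommGroup G] {n : ℕ} {V : Set (X × X)} (hV : V ∈ F.filter) {r : ℝ} {𝓤 : CoverPair X A}
    {φ : Set X → X} (hφ : IsSampling id 𝓤 A r φ) (h : nearDiagonal X (r + r) ⊆ V)
    (c : (ripsPair V A).Cohomology G n) :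
    ripsToCech A hF G n hV c =
      CechCohomology.of G n 𝓤 (SimplicialPair.cohomologyMap (hφ.isMap h) G n c) :=
  have h' := (exists_isSampling_of_mem A hF hV).choose_spec.choose_spec.choose_spec
  IsSampling.of_eq_of h'.2 h'.1 hφ h c

open Classical in
/-- The homomorphism from Vietoris-Rips to Čech cohomology induced by samplings. -/
noncomputable def vrToCech [Nonempty X] (A : Set X) (hF : IsMetricSemiUniformity F) (G : Type*)
    [AddCommGroup G] (n : ℕ) : VRCohomology F A G n →+ CechCohomology A G n :=
  AddCommGroup.DirectLimit.lift _ _ _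
    (fun V => ripsToCech A hF G n (OrderDual.ofDual V).2)
    (by
      intro V V' h c
      obtain ⟨r, 𝓤, φ, hr, hφ⟩ := exists_isSampling_of_mem A hF (OrderDual.ofDual V').2
      have h' : (OrderDual.ofDual V').1 ⊆ (OrderDual.ofDual V).1 := h
      rw [ripsToCech_eq hF _ hφ hr, ripsToCech_eq hF _ hφ (hr.trans h'), ripsRestrict,
        SimplicialPair.cohomologyMap_comp])

theorem vrToCech_of [Nonempty X] (hF : IsMetricSemiUniformity F) {G : Type*}
    [AddCommGroup G] {n : ℕ} {V : Set (X × X)} (hV : V ∈ F.filter) {r : ℝ} {𝓤 : CoverPair X A}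
    {φ : Set X → X} (hφ : IsSampling id 𝓤 A r φ) (h : nearDiagonal X (r + r) ⊆ V)
    (c : (ripsPair V A).Cohomology G n) :
    vrToCech A hF G n (VRCohomology.of F A G n hV c) =
      CechCohomology.of G n 𝓤 (SimplicialPair.cohomologyMap (hφ.isMap h) G n c) := by
  classical
  rw [← ripsToCech_eq hF hV hφ h]
  exact AddCommGroup.DirectLimit.lift_of _ _ _ _ _

/-- The homomorphism from the cohomology of a nerve to Vietoris-Rips cohomology that is induced by
any selection. -/
noncomputable def nerveToVR [CompactSpace X] (hA : IsCompact A) (hF : IsMetricSemiUniformity F)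
    (G : Type*) [AddCommGroup G] (n : ℕ) (𝓤 : CoverPair X A) :
    𝓤.nerve.Cohomology G n →+ VRCohomology F A G n :=
  have h := (exists_isSelection hA 𝓤).choose_spec.choose_spec
  (VRCohomology.of F A G n (hF.nearDiagonal_mem h.pos)).comp
    (SimplicialPair.cohomologyMap (h.isMap subset_rfl) G n)

theorem nerveToVR_eq [CompactSpace X] (hA : IsCompact A) (hF : IsMetricSemiUniformity F)
    {G : Type*} [AddCommGroup G] {n : ℕ} {𝓤 : CoverPair X A} {δ : ℝ} {φ : X → Set X}
    (hφ : IsSelection 𝓤 δ φ) {V : Set (X × X)} (hV : V ∈ F.filter) (h : V ⊆ nearDiagonal X δ)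
    (c : 𝓤.nerve.Cohomology G n) :
    nerveToVR hA hF G n 𝓤 c =
      VRCohomology.of F A G n hV (SimplicialPair.cohomologyMap (hφ.isMap h) G n c) :=
  have h' := (exists_isSelection hA 𝓤).choose_spec.choose_spec
  IsSelection.of_eq_of h' subset_rfl (hF.nearDiagonal_mem h'.pos) hφ h hV c

open Classical in
/-- The homomorphism from Čech to Vietoris-Rips cohomology induced by selections. -/
noncomputable def cechToVR [CompactSpace X] (hA : IsCompact A) (hF : IsMetricSemiUniformity F)
    (G : Type*) [AddCommGroup G] (n : ℕ) : CechCohomology A G n →+ VRCohomology F A G n :=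
  AddCommGroup.DirectLimit.lift _ _ _ (nerveToVR hA hF G n)
    (by
      intro 𝓤 𝓤' h c
      obtain ⟨δ, φ, hφ⟩ := exists_isSelection hA 𝓤'
      obtain ⟨p, hp⟩ := CoverPair.exists_isProjection_of_le h
      have hδ := hF.nearDiagonal_mem hφ.pos
      rw [nerveToVR_eq hA hF hφ hδ subset_rfl,
        nerveToVR_eq hA hF (hφ.comp_projection hp) hδ subset_rfl, CoverPair.nerveMap_eq _ hp,
        SimplicialPair.cohomologyMap_comp])

theorem cechToVR_of [CompactSpace X] (hA : IsCompact A) (hF : IsMetricSemiUniformity F)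
    {G : Type*} [AddCommGroup G] {n : ℕ} {𝓤 : CoverPair X A} {δ : ℝ} {φ : X → Set X}
    (hφ : IsSelection 𝓤 δ φ) {V : Set (X × X)} (hV : V ∈ F.filter) (h : V ⊆ nearDiagonal X δ)
    (c : 𝓤.nerve.Cohomology G n) :
    cechToVR hA hF G n (CechCohomology.of G n 𝓤 c) =
      VRCohomology.of F A G n hV (SimplicialPair.cohomologyMap (hφ.isMap h) G n c) := by
  classical
  rw [← nerveToVR_eq hA hF hφ hV h]
  exact AddCommGroup.DirectLimit.lift_of _ _ _ _ _

theorem cechToVR_vrToCech [CompactSpace X] [Nonempty X] (hA : IsCompact A)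
    (hF : IsMetricSemiUniformity F) {G : Type*} [AddCommGroup G] {n : ℕ} {V : Set (X × X)}
    (hV : V ∈ F.filter) (c : (ripsPair V A).Cohomology G n) :
    cechToVR hA hF G n (vrToCech A hF G n (VRCohomology.of F A G n hV c)) =
      VRCohomology.of F A G n hV c := by
  obtain ⟨r, 𝓤, φ, hr, hφ⟩ := exists_isSampling_of_mem A hF hV
  obtain ⟨δ, ψ, hψ⟩ := exists_isSelection hA 𝓤
  have hr0 : 0 < r := by
    obtain ⟨x⟩ := ‹Nonempty X›
    obtain ⟨U, hU, hx⟩ := 𝓤.cover x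
    exact dist_nonneg.trans_lt (hφ.dist_lt U hU x hx)
  -- The scale is taken to be at most `r`, so that a single vertex of a simplex is within `r` of
  -- its other vertices as well as of their images under `φ ∘ ψ`.
  have hψ' := hψ.mono (lt_min hψ.pos hr0) (min_le_left δ r)
  set W := V ∩ nearDiagonal X (min δ r) with hW
  have hWF : W ∈ F.filter := Filter.inter_mem hV (hF.nearDiagonal_mem hψ'.pos)
  have hWδ : W ⊆ nearDiagonal X (min δ r) := Set.inter_subset_right
  rw [vrToCech_of hF hV hφ hr, cechToVR_of hA hF hψ' hWF hWδ,
    ← VRCohomology.of_ripsRestrict G n hV hWF Set.inter_subset_left, ripsRestrict,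
    SimplicialPair.cohomologyMap_comp]
  congr 1
  have key : ∀ {B : Set X} {s : Finset X}, s ∈ ripsComplex W B → ∃ p, ∀ x ∈ s,
      dist (φ (ψ x)) p < r ∧ dist x p < r := by
    intro B s hs
    obtain ⟨p, hp⟩ := hs.1
    refine ⟨p, fun x hx => ⟨hφ.dist_lt _ (hψ.mem x) p (hψ'.ball_subset x ?_), ?_⟩⟩
    · exact dist_lt_of_mem_ripsComplex hψ'.pos hWδ hs hp hx
    · exact (dist_lt_of_mem_ripsComplex hψ'.pos hWδ hs hx hp).trans_le (min_le_right δ r)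
  refine SimplicialPair.cohomologyMap_eq_of_contiguous _ _ ?_ ?_ n c
  · refine contiguous_ripsComplex hr fun s hs => ?_
    obtain ⟨p, hp⟩ := key hs
    exact ⟨p, fun x hx => ⟨⟨trivial, (hp x hx).1⟩, ⟨trivial, (hp x hx).2⟩⟩⟩
  · refine contiguous_ripsComplex hr fun s hs => ?_
    obtain ⟨p, hp⟩ := key hs
    exact ⟨p, fun x hx => ⟨⟨hφ.mem_sub _ (hψ.mem_sub x (hs.2.1 x hx)), (hp x hx).1⟩,
      ⟨hs.2.1 x hx, (hp x hx).2⟩⟩⟩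

theorem vrToCech_cechToVR [CompactSpace X] [Nonempty X] (hA : IsCompact A)
    (hF : IsMetricSemiUniformity F) {G : Type*} [AddCommGroup G] {n : ℕ} (𝓤 : CoverPair X A)
    (c : 𝓤.nerve.Cohomology G n) :
    vrToCech A hF G n (cechToVR hA hF G n (CechCohomology.of G n 𝓤 c)) =
      CechCohomology.of G n 𝓤 c := by
  obtain ⟨δ, ψ, hψ⟩ := exists_isSelection hA 𝓤
  have hδ := hF.nearDiagonal_mem hψ.pos
  obtain ⟨𝓥, φ, hφ⟩ := exists_isSampling A (half_pos hψ.pos)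
  have hφ' := hφ.mono (half_le_self hψ.pos.le)
  -- The member selected for the sample point of `V` contains the `δ`-ball around that point, and
  -- this ball contains `V`.
  have hp : CoverPair.IsProjection id 𝓥 𝓤 (ψ ∘ φ) :=
    ⟨fun V _ => hψ.mem _,
      fun V hV x hx => hψ.ball_subset _ (Metric.mem_ball'.2 (hφ'.dist_lt V hV x hx)),
      fun V hV => hψ.mem_sub _ (hφ.mem_sub V hV)⟩
  rw [cechToVR_of hA hF hψ hδ subset_rfl,
    vrToCech_of hF hδ hφ (by rw [add_halves]), SimplicialPair.cohomologyMap_comp,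
    CechCohomology.of_projection hp]

/-- Vietoris-Rips and Čech cohomology of a non-empty compact metric pair are isomorphic. -/
noncomputable def vrEquivCech [CompactSpace X] [Nonempty X] (hA : IsCompact A)
    (hF : IsMetricSemiUniformity F) (G : Type*) [AddCommGroup G] (n : ℕ) :
    VRCohomology F A G n ≃+ CechCohomology A G n :=
  AddMonoidHom.toAddEquiv (vrToCech A hF G n) (cechToVR hA hF G n)
    (VRCohomology.hom_ext fun _ hV c => cechToVR_vrToCech hA hF hV c)
    (CechCohomology.hom_ext fun 𝓤 c => vrToCech_cechToVR hA hF 𝓤 c)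

end Iso

/-! ### Naturality -/

theorem vrToCech_map {X Y : Type*} [MetricSpace X] [MetricSpace Y] [Nonempty X] [Nonempty Y]
    {A : Set X} {B : Set Y} {F : SemiUniformity X} {F' : SemiUniformity Y}
    (hF : IsMetricSemiUniformity F) (hF' : IsMetricSemiUniformity F') {f : X → Y}
    (hf : UniformContinuous f) (hfF : F.UnifContinuous F' f) (hAB : Set.MapsTo f A B)
    {G : Type*} [AddCommGroup G] {n : ℕ} (c : VRCohomology F' B G n) :
    vrToCech A hF G n (VRCohomology.map hfF hAB G n c) =
      CechCohomology.map hf.continuous hAB G n (vrToCech B hF' G n c) := by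
  classical
  suffices h : (vrToCech A hF G n).comp (VRCohomology.map hfF hAB G n) =
      (CechCohomology.map hf.continuous hAB G n).comp (vrToCech B hF' G n) from
    DFunLike.congr_fun h c
  refine VRCohomology.hom_ext fun V hV c => ?_
  change vrToCech A hF G n (VRCohomology.map hfF hAB G n (VRCohomology.of F' B G n hV c)) =
    CechCohomology.map hf.continuous hAB G n
      (vrToCech B hF' G n (VRCohomology.of F' B G n hV c))
  have hmap : VRCohomology.map hfF hAB G n (VRCohomology.of F' B G n hV c) =
      VRCohomology.of F A G n (VRCohomology.preimage_mem hfF hV)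
        (VRCohomology.pullback hAB V G n c) :=
    AddCommGroup.DirectLimit.lift_of _ _ _ _ _
  obtain ⟨r, hr, hrV⟩ := (hF' V).1 hV
  have hrV' : nearDiagonal Y (r / 2 + r / 2) ⊆ V := by rwa [add_halves]
  obtain ⟨𝓥, φ, hφ⟩ := exists_isSampling B (half_pos hr)
  obtain ⟨δ, hδ, hδf⟩ := Metric.uniformContinuous_iff.1 hf (r / 2) (half_pos hr)
  obtain ⟨ε, hε, hεV⟩ := (hF _).1 (VRCohomology.preimage_mem hfF hV)
  have hmin : 0 < min δ (ε / 2) := lt_min hδ (half_pos hε)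
  obtain ⟨𝓤, ψ, hψ⟩ := exists_isSampling A hmin
  have hψV : nearDiagonal X (min δ (ε / 2) + min δ (ε / 2)) ⊆ Prod.map f f ⁻¹' V := by
    refine (nearDiagonal_mono ?_).trans hεV
    linarith [min_le_right δ (ε / 2)]
  obtain ⟨p, hp⟩ := 𝓥.exists_isProjection_preimage hf.continuous hAB
  -- Both sides are induced by samplings over `f`.
  have hfψ : IsSampling f 𝓤 B (r / 2) (f ∘ ψ) :=
    ⟨fun U hU x hx => hδf ((hψ.dist_lt U hU x hx).trans_le (min_le_left _ _)),
      fun U hU => hAB (hψ.mem_sub U hU)⟩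
  rw [hmap, vrToCech_of hF _ hψ hψV, vrToCech_of hF' hV hφ hrV', CechCohomology.map_of _ hAB hp,
    VRCohomology.pullback, SimplicialPair.cohomologyMap_comp, SimplicialPair.cohomologyMap_comp]
  exact hfψ.of_eq_of hrV' (hφ.comp_projection hp) hrV' c

/-! ### The empty space -/

/-- A simplicial pair without simplices has no cohomology. -/
theorem SimplicialPair.subsingleton_cohomology {V : Type*} (P : SimplicialPair V)
    (hP : ∀ s, s ∉ P.K) (G : Type*) [AddCommGroup G] (n : ℕ) :
    Subsingleton (P.Cohomology G n) := by
  have : IsEmpty (OrdSimplex P.K (n + 1)) := ⟨fun ⟨_, s, hs, _⟩ => hP s hs⟩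
  have : Subsingleton (P.cochains G n) :=
    ⟨fun f g => Subtype.ext (funext fun x => isEmptyElim x)⟩
  exact (QuotientAddGroup.mk_surjective).subsingleton

theorem AddCommGroup.DirectLimit.subsingleton {ι : Type*} [Preorder ι] [DecidableEq ι]
    {H : ι → Type*} [∀ i, AddCommGroup (H i)] (f : ∀ i j, i ≤ j → H i →+ H j)
    (h : ∀ i, Subsingleton (H i)) : Subsingleton (AddCommGroup.DirectLimit H f) := by
  have h0 : AddMonoidHom.id (AddCommGroup.DirectLimit H f) = 0 :=
    AddCommGroup.DirectLimit.hom_ext _ fun i => AddMonoidHom.ext fun x => by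
      rw [Subsingleton.elim x 0, map_zero, map_zero]
  exact ⟨fun x y => (DFunLike.congr_fun h0 x).trans (DFunLike.congr_fun h0 y).symm⟩

theorem VRCohomology.subsingleton_of_isEmpty {X : Type*} [IsEmpty X] (F : SemiUniformity X)
    (A : Set X) (G : Type*) [AddCommGroup G] (n : ℕ) : Subsingleton (VRCohomology F A G n) := by
  classical
  exact AddCommGroup.DirectLimit.subsingleton _ fun U =>
    SimplicialPair.subsingleton_cohomology _ (by rintro s ⟨⟨x, -⟩, -⟩; exact isEmptyElim x) G n

theorem CechCohomology.subsingleton_of_isEmpty {X : Type*} [TopologicalSpace X] [IsEmpty X]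
    (A : Set X) (G : Type*) [AddCommGroup G] (n : ℕ) : Subsingleton (CechCohomology A G n) := by
  classical
  exact AddCommGroup.DirectLimit.subsingleton _ fun 𝓤 =>
    SimplicialPair.subsingleton_cohomology _ (by rintro s ⟨-, -, x, -⟩; exact isEmptyElim x) G n

/-! ### Compact metric pairs -/

theorem CompactMetricPair.isMetricSemiUniformity_zero (P : CompactMetricPair.{u}) :
    IsMetricSemiUniformity P.semiUniformityZero := by
  intro U
  change (∃ r > 0, ∀ x y, ((SemiPseudometric.ofMetric P.carrier).shift 0).toFun x y < r →
    (x, y) ∈ U) ↔ _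
  simp only [CompactMetricPair.shift_zero_toFun]
  exact ⟨fun ⟨r, hr, h⟩ => ⟨r, hr, fun p hp => h p.1 p.2 hp⟩,
    fun ⟨r, hr, h⟩ => ⟨r, hr, fun x y hxy => h hxy⟩⟩

open Classical in
/-- The isomorphism between Vietoris-Rips and Čech cohomology of a compact metric pair. If the
space is empty, both groups are trivial and it is the zero homomorphism. -/
noncomputable def CompactMetricPair.vrEquivCech (P : CompactMetricPair.{u}) (G : Type v)
    [AddCommGroup G] (n : ℕ) : P.VR G n ≃+ P.Cech G n :=
  if h : Nonempty P.carrier then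
    _root_.vrEquivCech P.isCompact_sub P.isMetricSemiUniformity_zero G n
  else
    haveI := not_nonempty_iff.1 h
    haveI := VRCohomology.subsingleton_of_isEmpty P.semiUniformityZero P.sub G n
    haveI := CechCohomology.subsingleton_of_isEmpty P.sub G n
    AddMonoidHom.toAddEquiv (0 : P.VR G n →+ P.Cech G n) 0
      (AddMonoidHom.ext fun _ => Subsingleton.elim _ _)
      (AddMonoidHom.ext fun _ => Subsingleton.elim _ _)

theorem CompactMetricPair.vrEquivCech_apply (P : CompactMetricPair.{u}) [Nonempty P.carrier]
    (G : Type v) [AddCommGroup G] (n : ℕ) (c : P.VR G n) :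
    P.vrEquivCech G n c = vrToCech P.sub P.isMetricSemiUniformity_zero G n c := by
  rw [CompactMetricPair.vrEquivCech, dif_pos ‹_›]
  rfl

/-- On the category of compact metric pairs, the Vietoris-Rips cohomology with respect to the
semi-uniform structure `𝓕₀` is naturally isomorphic to the Čech cohomology, in every degree and
with every coefficient group. -/
theorem mainTheorem6 (G : Type v) [AddCommGroup G] (n : ℕ) :
    ∃ Φ : ∀ P : CompactMetricPair.{u}, P.VR G n ≃+ P.Cech G n,
      ∀ (P Q : CompactMetricPair.{u}) (f : CompactMetricPair.Hom P Q) (c : Q.VR G n),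
        Φ P (f.mapVR G n c) = f.mapCech G n (Φ Q c) := by
  refine ⟨fun P => P.vrEquivCech G n, fun P Q f c => ?_⟩
  rcases isEmpty_or_nonempty P.carrier with hP | ⟨⟨x⟩⟩
  · have := CechCohomology.subsingleton_of_isEmpty P.sub G n
    exact Subsingleton.elim _ _
  · have : Nonempty P.carrier := ⟨x⟩
    have : Nonempty Q.carrier := ⟨f.toFun x⟩
    rw [CompactMetricPair.vrEquivCech_apply, CompactMetricPair.vrEquivCech_apply]
    exact vrToCech_map _ _ (CompactSpace.uniformContinuous_of_continuous f.continuous)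
      f.unifContinuous f.mapsTo c
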